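/- Let $N$ be a network with a finite set of cells and $k\ge 1$ edge types, in which every cell $c$ is the target of exactly one edge of each type $i$; let $\sigma_i(c)$ be the source of that edge. Assume that $N$ is feed-forward with layers $C_0,\dots,C_m$: these nonempty sets partition the cells, $\sigma_i(c)=c$ for $c\in C_0$, $\sigma_i(C_j)\subseteq C_{j-1}$ for $1\le j\le m$, and every cell of $C_j$, $0\le j<m$, equals $\sigma_i(c')$ for some $i$ and some $c'\in C_{j+1}$. Let $\mathcal V_0(N)$ be the set of smooth $f:\mathbb R\times\mathbb R^k\times\mathbb R\to\mathbb R$, written $f(x_0,x_1,\dots,x_k,\lambda)$, with $f(0,\dots,0,\lambda)=0$ for all $\lambda$ and $f_0:=\frac{\partial f}{\partial x_0}(0,\dots,0)=0$, endowed with the $C^\infty$ topology (uniform convergence of all derivatives on compact sets). A property holds for generic $f\in\mathcal V_0(N)$ if it holds for all $f$ in some open dense subset. A domain is an interval $D$ of the form $]-\lambda_0,0]$, $]-\lambda_0,\lambda_0[$ or $[0,\lambda_0[$ with $\lambda_0>0$. A bifurcation branch of $f$ on $N$ is a continuous map $b=(b_c)_c:D\to\mathbb R^{|N|}$ on a domain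 $D$, smooth in the interior of $D$, with $b(0)=0$ and $$f\bigl(b_c(\lambda),b_{\sigma_1(c)}(\lambda),\dots,b_{\sigma_k(c)}(\lambda),\lambda\bigr)=0\quad\text{for every cell } c \text{ and } \lambda\in D,$$ that does not vanish identically on $D$ near $0$. Branches are regarded as germs at $0$: a component $b_c$ is called zero if it vanishes on $D$ near $0$. Suppose first that $D$ is one-sided. If $b_c$ is zero, it has square-root-order $-1$ and slope $0$. If $b_c$ is not zero, it has square-root-order $p_c$ and slope $s_c$ if $p_c$ is the smallest integer $p\ge 0$ for which there is a smooth function $b_c^*$ on some $[0,\varepsilon[$ such that $b_c(\lambda)=b_c^*(|\lambda|^{2^{-p}})$ for all small $\lambda\in D$ and $\lim_{\lambda\to0,\ \lambda\in D\setminus\{0\}} b_c^*(|\lambda|)/\lambda$ exists and is nonzero, and $s_c$ is this limit for $p=p_c$. If $D=\,]-\lambda_0,\lambda_0[$, then $b_c$ has square-root-order $p_c$ and slope $s_c$ if its restrictions to $[0,\lambda_0[$ and to $]-\lambda_0,0]$ both do. For a set $A$ of cells, $b$ has square-root-order $p$ on $A$ if every $b_c$, $c\in A$, has a square-root-order and the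 maximum of these orders is $p$. Then for generic $f\in\mathcal V_0(N)$ the following holds: for every bifurcation branch $b$ of $f$ on $N$ there is an integer $r$ with $1\le r\le m$ such that $b_c$ is zero for every $c\in C_0\cup\dots\cup C_{r-1}$ and, for every $r\le j\le m$, $b$ has square-root-order $j-r$ on $C_j$. That is, $b$ has square-root-order $0$ on $C_r$, $1$ on $C_{r+1}$, and so on up to $m-r$ on $C_m$. -/

import Mathlib

open Set Filter Topology
open scoped ContDiff

/-- A network with cells `Cell` and `k` edge types, represented by its functions `σ₁, …, σ_k`:
`N.input i c` is the source of the unique edge of type `i` whose target is the cell `c`. -/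
structure Network (k : ℕ) (Cell : Type*) where
  input : Fin k → Cell → Cell

/-- `N` is a feed-forward network with layers `C 0, …, C m`. -/
structure Network.IsFeedForward {k m : ℕ} {Cell : Type*} (N : Network k Cell)
    (C : Fin (m + 1) → Set Cell) : Prop where
  /-- The layers form a partition of the set of cells. -/
  nonempty : ∀ j, (C j).Nonempty
  disjoint : ∀ j j', j ≠ j' → Disjoint (C j) (C j')
  cover : ∀ c, ∃ j, c ∈ C j
  /-- The cells of the first layer only receive inputs from themselves. -/
  first : ∀ i, ∀ c ∈ C 0, N.input i c = c
  /-- The cells of the layer `j + 1` only receive inputs from the layer `j`. -/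
  step : ∀ (j : Fin m) (i : Fin k), ∀ c ∈ C j.succ, N.input i c ∈ C j.castSucc
  /-- Every cell outside of the last layer is an input of some cell of the next layer. -/
  source : ∀ j : Fin m, ∀ c ∈ C j.castSucc, ∃ c' ∈ C j.succ, ∃ i, N.input i c' = c

/-- The smooth functions `f(x₀, (x₁, …, x_k), μ)` from `ℝ × ℝᵏ × ℝ` to `ℝ`. -/
structure SmoothFamily (k : ℕ) where
  toFun : ℝ × (Fin k → ℝ) × ℝ → ℝ
  smooth : ContDiff ℝ ∞ toFun

/-- The `C^∞` topology: uniform convergence on compact sets of all derivatives. -/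
noncomputable instance SmoothFamily.topology (k : ℕ) : TopologicalSpace (SmoothFamily k) :=
  ⨅ n : ℕ, TopologicalSpace.induced
    (fun f => (⟨iteratedFDeriv ℝ n f.toFun,
        f.smooth.continuous_iteratedFDeriv (by exact_mod_cast le_top)⟩ :
      C(ℝ × (Fin k → ℝ) × ℝ,
        ContinuousMultilinearMap ℝ (fun _ : Fin n => ℝ × (Fin k → ℝ) × ℝ) ℝ)))
    ContinuousMap.compactOpen

/-- `𝒱(N)`: the smooth families with `f(0, 0, …, 0, μ) = 0` for every `μ`.
It depends on `N` only through the number `k` of edge types. -/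
def familiesV (k : ℕ) : Set (SmoothFamily k) :=
  {f | ∀ μ : ℝ, f.toFun (0, 0, μ) = 0}

/-- `𝒱₀(N)`: the families in `𝒱(N)` with `f₀ = ∂f/∂x₀ (0, …, 0) = 0`. -/
noncomputable def familiesV₀ (k : ℕ) : Set (SmoothFamily k) :=
  {f | f ∈ familiesV k ∧ deriv (fun x : ℝ => f.toFun (x, 0, 0)) 0 = 0}

/-- A property holds for generic `f ∈ 𝒱₀(N)` if it holds on an open and dense subset of the
space `𝒱₀(N)`, with the `C^∞` topology. -/
def ForGenericV₀ (k : ℕ) (P : SmoothFamily k → Prop) : Prop :=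
  ∃ G : Set (familiesV₀ k), IsOpen G ∧ Dense G ∧ ∀ f ∈ G, P f

/-- The admissible vector field `f^N(x, μ)`. -/
def Network.field {k : ℕ} {Cell : Type*} (N : Network k Cell) (f : SmoothFamily k)
    (x : Cell → ℝ) (μ : ℝ) : Cell → ℝ :=
  fun c => f.toFun (x c, fun i => x (N.input i c), μ)

/-- The domains `]-μ₀, 0]`, `]-μ₀, μ₀[` and `[0, μ₀[`, with `μ₀ > 0`. -/
def IsBranchDomain (D : Set ℝ) : Prop :=
  ∃ μ₀ > 0, D = Ioc (-μ₀) 0 ∨ D = Ioo (-μ₀) μ₀ ∨ D = Ico 0 μ₀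

/-- `b : D → ℝ^N` represents an equilibrium branch of `f` on `N` through the origin. At the
endpoint `0` of a one-sided domain only continuity is required, since branches that grow like
`|μ| ^ (1/2)` are not differentiable there; at the interior points of `D` the branch is smooth. -/
structure Network.IsEquilibriumBranch {k : ℕ} {Cell : Type*} [Fintype Cell] (N : Network k Cell)
    (f : SmoothFamily k) (D : Set ℝ) (b : ℝ → Cell → ℝ) : Prop where
  continuousOn : ContinuousOn b D
  smooth : ContDiffOn ℝ ∞ b (interior D)
  zero : b 0 = 0
  equilibrium : ∀ μ ∈ D, N.field f (b μ) μ = 0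

/-- A function on `D` vanishes as a germ at `0`. -/
def GermZero {E : Type*} [Zero E] (D : Set ℝ) (g : ℝ → E) : Prop :=
  ∀ᶠ μ in 𝓝[D] 0, g μ = 0

/-- A bifurcation branch is an equilibrium branch whose germ is not the trivial one. -/
def Network.IsBifurcationBranch {k : ℕ} {Cell : Type*} [Fintype Cell] (N : Network k Cell)
    (f : SmoothFamily k) (D : Set ℝ) (b : ℝ → Cell → ℝ) : Prop :=
  N.IsEquilibriumBranch f D b ∧ ¬ GermZero D b

/-- There is a smooth function `g*` on some `[0, ε[` such that `g(μ) = g*(|μ| ^ (2 ^ (-p)))` for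
small `μ ∈ D`, and `g*(|μ|) / μ` tends to `s ≠ 0` as `μ → 0` in `D \ {0}`. -/
def HasRootForm (D : Set ℝ) (g : ℝ → ℝ) (p : ℕ) (s : ℝ) : Prop :=
  ∃ ε > 0, ∃ g' : ℝ → ℝ, ContDiffOn ℝ ∞ g' (Ico 0 ε) ∧
    (∀ᶠ μ in 𝓝[D] 0, g μ = g' (|μ| ^ ((2 : ℝ) ^ (-(p : ℝ))))) ∧
    Tendsto (fun μ => g' |μ| / μ) (𝓝[D \ {0}] 0) (𝓝 s) ∧ s ≠ 0

/-- For `D = [0, μ₀[` or `D = ]-μ₀, 0]`: the germ `g` has square-root-order `p` and slope `s`. -/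
def HasOneSidedSqrtOrder (D : Set ℝ) (g : ℝ → ℝ) (p : ℤ) (s : ℝ) : Prop :=
  (GermZero D g ∧ p = -1 ∧ s = 0) ∨
    (¬ GermZero D g ∧ ∃ q : ℕ, p = q ∧
      IsLeast {q' : ℕ | ∃ s', HasRootForm D g q' s'} q ∧ HasRootForm D g q s)

/-- Square-root-order `p` and slope `s` of a germ `g` on any domain `D`. If `D` is a neighborhood
of `0`, then the restrictions of `g` to the nonnegative and to the nonpositive parameters of `D`
must both have square-root-order `p` and slope `s`. -/
def HasSqrtOrder (D : Set ℝ) (g : ℝ → ℝ) (p : ℤ) (s : ℝ) : Prop :=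
  (D ∩ Ici 0 ≠ {0} → HasOneSidedSqrtOrder (D ∩ Ici 0) g p s) ∧
    (D ∩ Iic 0 ≠ {0} → HasOneSidedSqrtOrder (D ∩ Iic 0) g p s)

/-- `b_A ∼ 𝒪(2 ^ (-p))`: all the components `b_c` with `c ∈ A` have a square-root-order, and the
maximum of these orders is `p`. -/
def HasSqrtOrderOn {Cell : Type*} (D : Set ℝ) (b : ℝ → Cell → ℝ) (A : Set Cell) (p : ℤ) : Prop :=
  (∀ c ∈ A, ∃ q s, HasSqrtOrder D (fun μ => b μ c) q s) ∧
    IsGreatest {q : ℤ | ∃ c ∈ A, ∃ s, HasSqrtOrder D (fun μ => b μ c) q s} p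

/-!
On each side of `0`, write `t = |μ|`. The behaviour of a branch of `f ∈ 𝒱₀` is decided cell by
cell, along the layers, by the derivatives `aᵢ = ∂f/∂xᵢ`, `q = ∂²f/∂x₀²` and `l = ∂²f/∂x₀∂μ` at the
origin.

* In layer `0` the equation is `f(x, …, x, μ) = 0`, with the linear coefficient `∑ aᵢ ≠ 0`, so
  that `x = 0` (`eventually_zero_of_self_input`).
* A cell with vanishing inputs undergoes a transcritical bifurcation: `x = 0` or
  `x = -2 (l / q) μ + ⋯`, a smooth function of `μ` (`zero_or_rootGerm_of_zero_inputs`).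
* If the largest inputs grow like `u`, the `2 ^ n`-th root of `t`, with the coefficients `sᵢ`, and
  `A = ∑ aᵢ sᵢ ≠ 0`, the equation reads `q x² / 2 + A u + ⋯ = 0`. This is a fold: `x` is a smooth
  function of `√u` with the leading coefficient `±√(-2 A / q)` (`rootGerm_succ_of_inputs`).
  Hadamard's lemma turns the equation into `u = x² N(u, x)`, and after extraction of the square
  root the implicit function theorem applies.

Hence the order of growth goes up by one from layer to layer, beginning with the first layer where
the branch does not vanish (`Network.IsSideBranch.layers`). On a two-sided domain the branch is
differentiable at `0`, which excludes square roots and forces `r = m`.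

All this needs that `q`, `l` and the sums `A` do not vanish. Only finitely many functions of the
jet occur as leading coefficients (`leadFuns`), and they are continuous where `q ≠ 0`, so that this
is an open condition. For density, extend the `2`-adic valuation of `ℚ` to `ℝ`; the reals with a
given integer as additive valuation are dense. If the additive valuation of `aᵢ` is `B ^ i` for a
large `B`, then the digits in base `B` show that the terms of each sum `A`, which contain iterated
square roots of other such sums, have different valuations. So they cannot cancel
(`mem_nondegenerateJets_of_valuation`).
-/

/-! ### Smooth functions: Hadamard's lemma, extension of germs, implicit functions -/

/-- An integral over `[0, 1]` of a family of functions depending smoothly on a parameter. -/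
theorem contDiff_intervalIntegral_param {E : Type} [NormedAddCommGroup E] [NormedSpace ℝ E]
    [FiniteDimensional ℝ E] (n : ℕ) :
    ∀ {F : Type} [NormedAddCommGroup F] [NormedSpace ℝ F] [CompleteSpace F] (G : E × ℝ → F),
      ContDiff ℝ ∞ G → ContDiff ℝ n (fun x => ∫ s in (0 : ℝ)..1, G (x, s)) := by
  induction n with
  | zero =>
    intro F _ _ _ G hG
    rw [Nat.cast_zero, contDiff_zero]
    exact intervalIntegral.continuous_parametric_intervalIntegral_of_continuous'
      (f := fun x s => G (x, s)) (by simpa [Function.uncurry_def] using hG.continuous) 0 1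
  | succ n ih =>
    intro F _ _ _ G hG
    let G' : E × ℝ → E →L[ℝ] F := fun p => (fderiv ℝ G p).comp (ContinuousLinearMap.inl ℝ E ℝ)
    have hG' : ContDiff ℝ ∞ G' := by
      have : ContDiff ℝ ∞ (fderiv ℝ G) := hG.fderiv_right (m := ∞) (by simp)
      exact this.clm_comp contDiff_const
    have hpart : ∀ x s, HasFDerivAt (fun x => G (x, s)) (G' (x, s)) x := by
      intro x s
      have h1 : HasFDerivAt G (fderiv ℝ G (x, s)) (x, s) :=
        (hG.differentiable (by simp) _).hasFDerivAt
      exact h1.comp x (hasFDerivAt_prodMk_left x s)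
    have hder : ∀ x₀, HasFDerivAt (fun x => ∫ s in (0 : ℝ)..1, G (x, s))
        (∫ s in (0 : ℝ)..1, G' (x₀, s)) x₀ := by
      intro x₀
      have : ProperSpace E := FiniteDimensional.proper ℝ E
      obtain ⟨M, hM⟩ := ((isCompact_closedBall x₀ 1).prod
        (isCompact_Icc (a := (0 : ℝ)) (b := 1))).exists_bound_of_continuousOn
        hG'.continuous.continuousOn
      refine intervalIntegral.hasFDerivAt_integral_of_dominated_of_fderiv_le
        (F := fun x s => G (x, s)) (F' := fun x s => G' (x, s)) (bound := fun _ => M)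
        (Metric.closedBall_mem_nhds x₀ one_pos) ?_ ?_ ?_ ?_ ?_ ?_
      · exact Eventually.of_forall fun x =>
          (hG.continuous.comp (by fun_prop : Continuous fun s : ℝ => (x, s))).aestronglyMeasurable
      · exact (hG.continuous.comp
          (by fun_prop : Continuous fun s : ℝ => (x₀, s))).intervalIntegrable _ _
      · exact (hG'.continuous.comp
          (by fun_prop : Continuous fun s : ℝ => (x₀, s))).aestronglyMeasurable
      · refine Eventually.of_forall fun s hs x hx => hM (x, s) ⟨hx, ?_⟩
        rw [uIoc_of_le zero_le_one] at hs
        exact Ioc_subset_Icc_self hs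
      · exact intervalIntegrable_const
      · exact Eventually.of_forall fun s _ x _ => hpart x s
    rw [show ((n + 1 : ℕ) : ℕ∞ω) = (n : ℕ∞ω) + 1 by push_cast; rfl, contDiff_succ_iff_fderiv]
    refine ⟨fun x => (hder x).differentiableAt, by simp, ?_⟩
    rw [show fderiv ℝ (fun x => ∫ s in (0 : ℝ)..1, G (x, s)) =
      fun x => ∫ s in (0 : ℝ)..1, G' (x, s) from funext fun x => (hder x).fderiv]
    exact ih G' hG'

/-- Hadamard's lemma, with parameters. -/
theorem exists_smooth_eq_add_mul {Z : Type} [NormedAddCommGroup Z] [NormedSpace ℝ Z]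
    [FiniteDimensional ℝ Z] {F : ℝ × Z → ℝ} (hF : ContDiff ℝ ∞ F) :
    ∃ F₁ : ℝ × Z → ℝ, ContDiff ℝ ∞ F₁ ∧ ∀ x z, F (x, z) = F (0, z) + x * F₁ (x, z) := by
  have hF' : ContDiff ℝ ∞ (fderiv ℝ F) := hF.fderiv_right (m := ∞) (by simp)
  let G : (ℝ × Z) × ℝ → ℝ := fun p => fderiv ℝ F (p.2 * p.1.1, p.1.2) (1, 0)
  have hG : ContDiff ℝ ∞ G := by
    refine ContDiff.clm_apply (hF'.comp ?_) contDiff_const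
    fun_prop
  refine ⟨fun p => ∫ s in (0 : ℝ)..1, G (p, s),
    contDiff_infty.2 fun n => contDiff_intervalIntegral_param n G hG, fun x z => ?_⟩
  have hder : ∀ s ∈ uIcc (0 : ℝ) 1,
      HasDerivAt (fun s => F (s * x, z)) (x * G ((x, z), s)) s := by
    intro s _
    have h1 : HasFDerivAt F (fderiv ℝ F (s * x, z)) (s * x, z) :=
      (hF.differentiable (by simp) _).hasFDerivAt
    have h2 : HasDerivAt (fun s : ℝ => (s * x, z)) (x, 0) s := by
      simpa using ((hasDerivAt_id s).mul_const x).prodMk (hasDerivAt_const s z)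
    have h3 := h1.comp_hasDerivAt s h2
    have h4 : ((x, 0) : ℝ × Z) = x • (1, 0) := by simp
    rw [h4, map_smul, smul_eq_mul] at h3
    exact h3
  have hc : Continuous fun s => x * G ((x, z), s) :=
    continuous_const.mul (hG.continuous.comp (by fun_prop))
  have := intervalIntegral.integral_eq_sub_of_hasDerivAt hder (hc.intervalIntegrable _ _)
  rw [intervalIntegral.integral_const_mul] at this
  simp only [one_mul, zero_mul] at this
  linarith

/-- A function that is smooth near a point agrees near this point with a smooth function. -/
theorem exists_contDiff_eventuallyEq {g : ℝ → ℝ} {x₀ : ℝ}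
    (hg : ∀ᶠ x in 𝓝 x₀, ContDiffAt ℝ ∞ g x) :
    ∃ h : ℝ → ℝ, ContDiff ℝ ∞ h ∧ h =ᶠ[𝓝 x₀] g := by
  obtain ⟨r, hr, hball⟩ := Metric.eventually_nhds_iff_ball.1 hg
  let β : ContDiffBump x₀ := ⟨r / 4, r / 2, by positivity, by linarith⟩
  refine ⟨fun x => β x * g x, ?_, ?_⟩
  · rw [contDiff_iff_contDiffAt]
    intro x
    by_cases hx : x ∈ tsupport β
    · rw [β.tsupport_eq] at hx
      exact β.contDiffAt.mul (hball x (Metric.closedBall_subset_ball (by simp [β]; linarith) hx))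
    · refine (contDiffAt_const (c := (0 : ℝ))).congr_of_eventuallyEq ?_
      filter_upwards [notMem_tsupport_iff_eventuallyEq.1 hx] with y hy
      simp [hy]
  · filter_upwards [β.eventuallyEq_one] with x hx
    simp [hx]

/-- A smooth implicit function theorem for one unknown and one parameter: the zeros of `K` near the
origin form the graph of a smooth function. -/
theorem exists_smooth_implicit {K : ℝ × ℝ → ℝ} (hK : ∀ᶠ p in 𝓝 (0 : ℝ × ℝ), ContDiffAt ℝ ∞ K p)
    (h0 : K 0 = 0) {d : ℝ} (hd : HasDerivAt (fun x => K (0, x)) d 0) (hd0 : d ≠ 0) :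
    ∃ φ : ℝ → ℝ, ContDiff ℝ ∞ φ ∧ φ 0 = 0 ∧
      ∀ᶠ p in 𝓝 (0 : ℝ × ℝ), K p = 0 ↔ φ p.1 = p.2 := by
  have htop : (∞ : ℕ∞ω) ≠ 0 := by simp
  have hinv : ∀ L : ℝ × ℝ →L[ℝ] ℝ, L (0, 1) ≠ 0 → (L ∘L .inr ℝ ℝ ℝ).IsInvertible := by
    intro L hL
    refine ⟨ContinuousLinearEquiv.unitsEquivAut ℝ (Units.mk0 _ hL), ?_⟩
    ext
    simp
  have hdiff : ContDiffAt ℝ ∞ K 0 := hK.self_of_nhds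
  have hcont : ContinuousAt (fun p => fderiv ℝ K p (0, 1)) 0 :=
    ((hdiff.fderiv_right (m := ∞) (by simp)).continuousAt).clm_apply continuousAt_const
  have hd' : fderiv ℝ K 0 (0, 1) = d := by
    have h1 : HasFDerivAt K (fderiv ℝ K 0) (0, 0) := (hdiff.differentiableAt htop).hasFDerivAt
    have h2 : HasDerivAt (fun x : ℝ => ((0 : ℝ), x)) (0, 1) 0 :=
      (hasDerivAt_const _ _).prodMk (hasDerivAt_id _)
    exact (h1.comp_hasDerivAt (0 : ℝ) h2).unique hd
  have hne : ∀ᶠ p in 𝓝 (0 : ℝ × ℝ), fderiv ℝ K p (0, 1) ≠ 0 :=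
    hcont.eventually_ne (by rw [hd']; exact hd0)
  have if0 := hinv _ (hne.self_of_nhds)
  set ψ := hdiff.implicitFunction htop if0 with hψ
  have hψ0 : ψ 0 = 0 := hdiff.implicitFunction_apply_self htop if0
  have hψd : ContDiffAt ℝ ∞ ψ 0 := hdiff.contDiffAt_implicitFunction htop if0
  have hψc : ∀ᶠ t in 𝓝 (0 : ℝ), ContinuousAt ψ t := by
    have : ContDiffAt ℝ 1 ψ 0 := hψd.of_le (by exact_mod_cast le_top)
    filter_upwards [this.eventually (by simp)] with t ht using ht.continuousAt
  have hψe : ∀ᶠ t in 𝓝 (0 : ℝ), K (t, ψ t) = 0 := by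
    have := hdiff.eventually_apply_implicitFunction htop if0
    rwa [h0] at this
  have hψi : ∀ᶠ p in 𝓝 (0 : ℝ × ℝ), K p = 0 ↔ ψ p.1 = p.2 := by
    have := hdiff.eventually_apply_eq_iff_implicitFunction htop if0
    rwa [h0] at this
  have hgraph : Tendsto (fun t => (t, ψ t)) (𝓝 0) (𝓝 ((0, 0) : ℝ × ℝ)) := by
    have h := continuousAt_id.prodMk hψd.continuousAt
    simpa only [ContinuousAt, hψ0, id] using h
  have hsm : ∀ᶠ t in 𝓝 (0 : ℝ), ContDiffAt ℝ ∞ ψ t := by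
    filter_upwards [hgraph.eventually hK, hgraph.eventually hne, hψc,
      hψe.eventually_nhds] with t h1 h2 h3 h4
    -- near `(t, ψ t)` the zeros of `K` are also the graph of the implicit function based there
    have ift := hinv _ h2
    refine (h1.contDiffAt_implicitFunction htop ift).congr_of_eventuallyEq ?_
    have h5 := h1.eventually_apply_eq_iff_implicitFunction htop ift
    rw [h4.self_of_nhds] at h5
    have h6 : Tendsto (fun t' => (t', ψ t')) (𝓝 t) (𝓝 (t, ψ t)) := continuousAt_id.prodMk h3
    filter_upwards [h6.eventually h5, h4] with t' h7 h8
    exact (h7.1 h8).symm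
  obtain ⟨φ, hφ, hφψ⟩ := exists_contDiff_eventuallyEq hsm
  refine ⟨φ, hφ, by rw [hφψ.self_of_nhds, hψ0], ?_⟩
  have hfst : Tendsto (fun p : ℝ × ℝ => p.1) (𝓝 0) (𝓝 0) := continuous_fst.tendsto' _ _ rfl
  filter_upwards [hψi, hfst.eventually hφψ] with p h1 h2
  rw [h1, h2]

/-! ### Germs in a dyadic root of the parameter -/

/-- The `2 ^ p`-th root of `t`. -/
noncomputable def dyadicRoot (p : ℕ) (t : ℝ) : ℝ := t ^ ((2 : ℝ) ^ (-(p : ℝ)))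

theorem dyadicRoot_zero (t : ℝ) : dyadicRoot 0 t = t := by simp [dyadicRoot]

theorem dyadicRoot_pos (p : ℕ) {t : ℝ} (ht : 0 < t) : 0 < dyadicRoot p t :=
  Real.rpow_pos_of_pos ht _

theorem dyadicRoot_apply_zero (p : ℕ) : dyadicRoot p 0 = 0 :=
  Real.zero_rpow (by positivity)

theorem dyadicRoot_succ_sq (p : ℕ) {t : ℝ} (ht : 0 < t) :
    dyadicRoot (p + 1) t ^ 2 = dyadicRoot p t := by
  rw [dyadicRoot, dyadicRoot, ← Real.rpow_natCast, ← Real.rpow_mul ht.le]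
  congr 1
  rw [show -((p : ℕ) : ℝ) = -((p + 1 : ℕ) : ℝ) + 1 by push_cast; ring,
    Real.rpow_add two_pos]
  simp

theorem dyadicRoot_add_pow (p d : ℕ) {t : ℝ} (ht : 0 < t) :
    dyadicRoot (p + d) t ^ 2 ^ d = dyadicRoot p t := by
  induction d with
  | zero => simp
  | succ d ih => rw [pow_succ', pow_mul, ← add_assoc, dyadicRoot_succ_sq _ ht, ih]

theorem dyadicRoot_pow (n : ℕ) {t : ℝ} (ht : 0 < t) : dyadicRoot n t ^ 2 ^ n = t := by
  simpa [dyadicRoot_zero] using dyadicRoot_add_pow 0 n ht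

theorem tendsto_dyadicRoot (p : ℕ) : Tendsto (dyadicRoot p) (𝓝[>] 0) (𝓝[>] 0) := by
  refine tendsto_nhdsWithin_iff.2 ⟨?_, ?_⟩
  · have : ContinuousAt (dyadicRoot p) 0 :=
      Real.continuousAt_rpow_const _ _ (Or.inr (by positivity))
    have h := this.tendsto
    rw [dyadicRoot_apply_zero] at h
    exact h.mono_left nhdsWithin_le_nhds
  · filter_upwards [self_mem_nhdsWithin] with t ht using dyadicRoot_pos p ht

/-- `y` is, for small positive `t`, a smooth function of the `2 ^ p`-th root of `t` that vanishes
at `0` and has the derivative `s` there; `s = 0` is allowed. -/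
def RootGerm (y : ℝ → ℝ) (p : ℕ) (s : ℝ) : Prop :=
  ∃ g : ℝ → ℝ, ContDiff ℝ ∞ g ∧ g 0 = 0 ∧ HasDerivAt g s 0 ∧
    ∀ᶠ t in 𝓝[>] 0, y t = g (dyadicRoot p t)

theorem RootGerm.of_eventually_zero {y : ℝ → ℝ} (h : ∀ᶠ t in 𝓝[>] 0, y t = 0) (p : ℕ) :
    RootGerm y p 0 :=
  ⟨fun _ => 0, contDiff_const, rfl, hasDerivAt_const _ _, h⟩

/-- In terms of a higher root, the leading coefficient is lost. -/
theorem RootGerm.of_lt {y : ℝ → ℝ} {p n : ℕ} {s : ℝ} (h : RootGerm y p s) (hpn : p < n) :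
    RootGerm y n 0 := by
  obtain ⟨g, hg, hg0, hgd, hy⟩ := h
  obtain ⟨d, rfl⟩ := Nat.exists_eq_add_of_lt hpn
  have h2 : (2 : ℕ) ^ (d + 1) ≠ 0 := by positivity
  refine ⟨fun u => g (u ^ 2 ^ (d + 1)), hg.comp (contDiff_id.pow _), by simp [hg0], ?_, ?_⟩
  · have h1 : HasDerivAt (fun u : ℝ => u ^ 2 ^ (d + 1)) 0 0 := by
      have := hasDerivAt_pow (2 ^ (d + 1)) (0 : ℝ)
      have h3 : 2 ^ (d + 1) - 1 ≠ 0 := by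
        have : 2 ≤ 2 ^ (d + 1) := Nat.le_self_pow (by simp) 2
        omega
      simpa [zero_pow h3] using this
    have h4 : HasDerivAt g s ((0 : ℝ) ^ 2 ^ (d + 1)) := by rwa [zero_pow h2]
    have h5 := h4.comp (0 : ℝ) h1
    rw [mul_zero] at h5
    exact h5
  · filter_upwards [hy, self_mem_nhdsWithin] with t ht ht0
    rw [ht, add_assoc, dyadicRoot_add_pow p (d + 1) ht0]

theorem RootGerm.tendsto_div {y : ℝ → ℝ} {p : ℕ} {s : ℝ} (h : RootGerm y p s) :
    Tendsto (fun t => y t / dyadicRoot p t) (𝓝[>] 0) (𝓝 s) := by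
  obtain ⟨g, -, hg0, hgd, hy⟩ := h
  have h1 : Tendsto (slope g 0) (𝓝[>] 0) (𝓝 s) :=
    (hasDerivAt_iff_tendsto_slope.1 hgd).mono_left
      (nhdsWithin_mono _ fun x hx => (ne_of_gt hx : x ≠ 0))
  refine (h1.comp (tendsto_dyadicRoot p)).congr' ?_
  filter_upwards [hy] with t ht
  simp [slope_def_field, hg0, ht]

theorem not_eventually_zero_of_tendsto_div {y : ℝ → ℝ} {p : ℕ} {s : ℝ}
    (h : Tendsto (fun t => y t / dyadicRoot p t) (𝓝[>] 0) (𝓝 s)) (hs : s ≠ 0) :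
    ¬ ∀ᶠ t in 𝓝[>] 0, y t = 0 := by
  intro h0
  refine hs (tendsto_nhds_unique (h.congr' ?_) tendsto_const_nhds)
  filter_upwards [h0] with t ht
  simp [ht]

/-- A germ that is bounded by a multiple of a dyadic root does not grow like a higher one. -/
theorem not_lt_of_tendsto_div {y : ℝ → ℝ} {p p' : ℕ} {s s' : ℝ}
    (h : Tendsto (fun t => y t / dyadicRoot p t) (𝓝[>] 0) (𝓝 s))
    (h' : Tendsto (fun t => y t / dyadicRoot p' t) (𝓝[>] 0) (𝓝 s')) (hs' : s' ≠ 0) :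
    ¬ p < p' := by
  intro hlt
  obtain ⟨d, rfl⟩ := Nat.exists_eq_add_of_lt hlt
  have hpow : Tendsto (fun t => dyadicRoot (p + d + 1) t ^ (2 ^ (d + 1) - 1)) (𝓝[>] 0) (𝓝 0) := by
    have h1 := ((tendsto_dyadicRoot (p + d + 1)).mono_right nhdsWithin_le_nhds).pow
      (2 ^ (d + 1) - 1)
    have h3 : 2 ^ (d + 1) - 1 ≠ 0 := by
      have : 2 ≤ 2 ^ (d + 1) := Nat.le_self_pow (by simp) 2
      omega
    simpa [zero_pow h3] using h1
  have h2 := h.mul hpow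
  rw [mul_zero] at h2
  refine hs' (tendsto_nhds_unique (h'.congr' ?_) h2)
  filter_upwards [self_mem_nhdsWithin] with t ht
  have hpos := dyadicRoot_pos (p + d + 1) ht
  have heq : dyadicRoot p t =
      dyadicRoot (p + d + 1) t * dyadicRoot (p + d + 1) t ^ (2 ^ (d + 1) - 1) := by
    rw [← pow_succ', Nat.sub_add_cancel Nat.one_le_two_pow]
    exact (dyadicRoot_add_pow p (d + 1) ht).symm
  rw [heq]
  field_simp

theorem dyadic_order_unique {y : ℝ → ℝ} {p p' : ℕ} {s s' : ℝ}
    (h : Tendsto (fun t => y t / dyadicRoot p t) (𝓝[>] 0) (𝓝 s)) (hs : s ≠ 0)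
    (h' : Tendsto (fun t => y t / dyadicRoot p' t) (𝓝[>] 0) (𝓝 s')) (hs' : s' ≠ 0) : p = p' :=
  le_antisymm (not_lt.1 (not_lt_of_tendsto_div h' h hs)) (not_lt.1 (not_lt_of_tendsto_div h h' hs'))

/-- A germ that is continuous and nonzero for small `t > 0` has a constant sign. -/
theorem eventually_pos_or_neg {u : ℝ → ℝ} (hc : ∀ᶠ t in 𝓝[>] 0, ContinuousAt u t)
    (h0 : ∀ᶠ t in 𝓝[>] (0 : ℝ), u t ≠ 0) :
    (∀ᶠ t in 𝓝[>] 0, 0 < u t) ∨ ∀ᶠ t in 𝓝[>] 0, u t < 0 := by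
  obtain ⟨δ, hδ, h⟩ := mem_nhdsGT_iff_exists_Ioo_subset.1 (hc.and h0)
  have hδ : 0 < δ := hδ
  have hcont : ContinuousOn u (Ioo 0 δ) := fun t ht => (h ht).1.continuousWithinAt
  have key : ∀ a ∈ Ioo 0 δ, ∀ b ∈ Ioo 0 δ, 0 < u a → 0 < u b := by
    intro a ha b hb hua
    by_contra hub
    obtain ⟨c, hc, hc0⟩ := isPreconnected_Ioo.intermediate_value hb ha hcont
      ⟨not_lt.1 hub, hua.le⟩
    exact (h hc).2 hc0
  have hmem : Ioo 0 δ ∈ 𝓝[>] (0 : ℝ) := Ioo_mem_nhdsGT hδ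
  by_cases hpos : ∃ a ∈ Ioo 0 δ, 0 < u a
  · obtain ⟨a, ha, hua⟩ := hpos
    exact Or.inl (by filter_upwards [hmem] with b hb using key a ha b hb hua)
  · push Not at hpos
    exact Or.inr (by filter_upwards [hmem] with b hb using lt_of_le_of_ne (hpos b hb) (h hb).2)

/-- The product rule at a common zero, where one factor need only be continuous. -/
theorem HasDerivAt.mul_continuousAt_of_eq_zero {φ w : ℝ → ℝ} {d : ℝ} (hφ : HasDerivAt φ d 0)
    (h0 : φ 0 = 0) (hw : ContinuousAt w 0) : HasDerivAt (fun x => φ x * w x) (d * w 0) 0 := by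
  rw [hasDerivAt_iff_tendsto_slope] at hφ ⊢
  refine (hφ.mul (hw.tendsto.mono_left nhdsWithin_le_nhds)).congr fun x => ?_
  simp only [slope_def_field, h0]
  ring

/-! ### The equation of a single cell -/

/-- Hadamard's lemma in one variable. -/
theorem exists_smooth_eq_mul {h : ℝ → ℝ} {d : ℝ} (hh : ContDiff ℝ ∞ h) (h0 : h 0 = 0)
    (hd : HasDerivAt h d 0) :
    ∃ α : ℝ → ℝ, ContDiff ℝ ∞ α ∧ α 0 = d ∧ ∀ u, h u = u * α u := by
  obtain ⟨F₁, hF₁, hF⟩ := exists_smooth_eq_add_mul (F := fun p : ℝ × ℝ => h p.1)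
    (hh.comp contDiff_fst)
  have hα : ContDiff ℝ ∞ fun u : ℝ => F₁ (u, 0) := hF₁.comp (by fun_prop)
  have heq : ∀ u, h u = u * F₁ (u, 0) := fun u => by simpa [h0] using hF u 0
  refine ⟨fun u => F₁ (u, 0), hα, ?_, heq⟩
  have h1 := (hasDerivAt_id (0 : ℝ)).mul_continuousAt_of_eq_zero rfl hα.continuous.continuousAt
  rw [one_mul] at h1
  exact h1.unique (hd.congr_of_eventuallyEq (Eventually.of_forall fun u => (heq u).symm))

/-- The expansion of second order in the first variable. -/
theorem exists_smooth_quadratic_expansion {Z : Type} [NormedAddCommGroup Z] [NormedSpace ℝ Z]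
    [FiniteDimensional ℝ Z] {F : ℝ × Z → ℝ} (hF : ContDiff ℝ ∞ F) :
    ∃ (G : Z → ℝ) (F₂ : ℝ × Z → ℝ), ContDiff ℝ ∞ G ∧ ContDiff ℝ ∞ F₂ ∧
      (∀ x z, F (x, z) = F (0, z) + x * (G z + x * F₂ (x, z))) ∧
      (∀ z, G z = fderiv ℝ F (0, z) (1, 0)) ∧
      2 * F₂ 0 = fderiv ℝ (fderiv ℝ F) 0 (1, 0) (1, 0) := by
  obtain ⟨F₁, hF₁, h1⟩ := exists_smooth_eq_add_mul hF
  obtain ⟨F₂, hF₂, h2⟩ := exists_smooth_eq_add_mul hF₁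
  have hG : ContDiff ℝ ∞ fun z : Z => F₁ (0, z) := hF₁.comp (by fun_prop)
  have hF' : ContDiff ℝ ∞ (fderiv ℝ F) := hF.fderiv_right (m := ∞) (by simp)
  have hline : ∀ x z, HasDerivAt (fun x => F (x, z)) (fderiv ℝ F (x, z) (1, 0)) x := fun x z =>
    ((hF.differentiable (by simp) (x, z)).hasFDerivAt).comp_hasDerivAt x
      ((hasDerivAt_id x).prodMk (hasDerivAt_const x z))
  have hGeq : ∀ z, F₁ (0, z) = fderiv ℝ F (0, z) (1, 0) := by
    intro z
    have hc : ContinuousAt (fun x : ℝ => F₁ (x, z)) 0 :=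
      (hF₁.continuous.comp (by fun_prop)).continuousAt
    have h3 := ((hasDerivAt_id (0 : ℝ)).mul_continuousAt_of_eq_zero rfl hc).const_add (F (0, z))
    rw [one_mul] at h3
    exact h3.unique ((hline 0 z).congr_of_eventuallyEq
      (Eventually.of_forall fun x => (h1 x z).symm))
  refine ⟨fun z => F₁ (0, z), F₂, hG, hF₂, fun x z => by rw [h1, h2], hGeq, ?_⟩
  -- the derivative of `F` along the line `z = 0` is `F₁ (0, 0) + x * (2 * F₂ + x * F₂')`
  let e : ℝ → ℝ := fun x => F₂ (x, 0)
  have he : ContDiff ℝ ∞ e := hF₂.comp (by fun_prop)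
  have he' : ∀ x, HasDerivAt e (deriv e x) x := fun x =>
    (he.differentiable (by simp) x).hasDerivAt
  have hder : ∀ x, fderiv ℝ F (x, 0) (1, 0) = F₁ (0, 0) + x * (2 * e x + x * deriv e x) := by
    intro x
    have h3 : HasDerivAt (fun x => F (0, 0) + x * (F₁ (0, 0) + x * e x))
        (1 * (F₁ (0, 0) + x * e x) + x * (1 * e x + x * deriv e x)) x :=
      ((hasDerivAt_id x).mul (((hasDerivAt_id x).mul (he' x)).const_add _)).const_add _
    have h4 := (hline x 0).unique (h3.congr_of_eventuallyEq
      (Eventually.of_forall fun x => by simp only [e]; rw [h1, h2]))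
    rw [h4]
    ring
  have hc : ContinuousAt (fun x => 2 * e x + x * deriv e x) 0 := by
    have := he.continuous_deriv (by simp)
    have := he.continuous
    fun_prop
  have h5 := ((hasDerivAt_id (0 : ℝ)).mul_continuousAt_of_eq_zero rfl hc).const_add (F₁ (0, 0))
  have h6 : HasDerivAt (fun x : ℝ => fderiv ℝ F (x, 0) (1, 0))
      (fderiv ℝ (fderiv ℝ F) 0 (1, 0) (1, 0)) 0 := by
    have h7 : HasDerivAt (fun x : ℝ => fderiv ℝ F (x, 0)) (fderiv ℝ (fderiv ℝ F) 0 (1, 0)) 0 :=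
      ((hF'.differentiable (by simp) ((0 : ℝ), (0 : Z))).hasFDerivAt).comp_hasDerivAt (0 : ℝ)
        ((hasDerivAt_id 0).prodMk (hasDerivAt_const 0 0))
    simpa using h7.clm_apply (hasDerivAt_const (0 : ℝ) ((1 : ℝ), (0 : Z)))
  have h8 := h6.unique (h5.congr_of_eventuallyEq (Eventually.of_forall fun x => hder x))
  rw [h8]
  simp only [e, zero_mul, add_zero, one_mul]
  rfl

/-- The unit vector in the direction of the state of the cell. -/
def cellDir (k : ℕ) : ℝ × (Fin k → ℝ) × ℝ := (1, 0)

/-- The unit vector in the direction of the parameter. -/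
def paramDir (k : ℕ) : ℝ × (Fin k → ℝ) × ℝ := (0, 0, 1)

/-- The unit vector in the direction of the input of type `i`. -/
def inputDir {k : ℕ} (i : Fin k) : ℝ × (Fin k → ℝ) × ℝ := (0, Pi.single i 1, 0)

theorem input_vector_eq_sum {k : ℕ} (s : Fin k → ℝ) :
    ((0, s, 0) : ℝ × (Fin k → ℝ) × ℝ) = ∑ i, s i • inputDir i := by
  have h : ((LinearMap.inr ℝ ℝ ((Fin k → ℝ) × ℝ)).comp (LinearMap.inl ℝ (Fin k → ℝ) ℝ)) s =
      ∑ i, s i • inputDir i := by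
    conv_lhs => rw [pi_eq_sum_univ' s]
    rw [map_sum]
    refine Finset.sum_congr rfl fun i _ => ?_
    rw [map_smul]
    rfl
  exact h

theorem fderiv_paramDir {k : ℕ} {F : ℝ × (Fin k → ℝ) × ℝ → ℝ} (hF : ContDiff ℝ ∞ F)
    (htriv : ∀ μ, F (0, 0, μ) = 0) : fderiv ℝ F 0 (paramDir k) = 0 := by
  have h1 : HasDerivAt (fun μ : ℝ => F (0, 0, μ)) (fderiv ℝ F 0 (paramDir k)) 0 :=
    ((hF.differentiable (by simp) (0, 0, 0)).hasFDerivAt).comp_hasDerivAt (0 : ℝ)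
      ((hasDerivAt_const _ _).prodMk ((hasDerivAt_const _ _).prodMk (hasDerivAt_id _)))
  simp only [htriv] at h1
  exact h1.unique (hasDerivAt_const _ _)

/-- A cell that only receives inputs from itself stays at the origin. -/
theorem eventually_zero_of_self_input {k : ℕ} {F : ℝ × (Fin k → ℝ) × ℝ → ℝ}
    (hF : ContDiff ℝ ∞ F) (htriv : ∀ μ, F (0, 0, μ) = 0)
    (hcell : fderiv ℝ F 0 (cellDir k) = 0) (hsum : ∑ i, fderiv ℝ F 0 (inputDir i) ≠ 0)
    (ε : ℝ) {x : ℝ → ℝ} (hx : Tendsto x (𝓝[>] 0) (𝓝 0))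
    (heq : ∀ᶠ t in 𝓝[>] 0, F (x t, fun _ => x t, ε * t) = 0) :
    ∀ᶠ t in 𝓝[>] 0, x t = 0 := by
  have hH : ContDiff ℝ ∞ fun p : ℝ × ℝ => F (p.1, fun _ => p.1, p.2) := hF.comp (by fun_prop)
  obtain ⟨H₁, hH₁, h1⟩ := exists_smooth_eq_add_mul hH
  have h1' : ∀ x z, F (x, fun _ => x, z) = x * H₁ (x, z) := by
    intro x z
    have := h1 x z
    simpa [show (fun _ : Fin k => (0 : ℝ)) = 0 from rfl, htriv] using this
  have hH0 : H₁ (0, 0) ≠ 0 := by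
    have hc : ContinuousAt (fun x : ℝ => H₁ (x, 0)) 0 :=
      (hH₁.continuous.comp (by fun_prop)).continuousAt
    have h2 := (hasDerivAt_id (0 : ℝ)).mul_continuousAt_of_eq_zero rfl hc
    have h3 : HasDerivAt (fun x : ℝ => F (x, fun _ => x, 0))
        (fderiv ℝ F 0 (1, fun _ => 1, 0)) 0 :=
      ((hF.differentiable (by simp) (0, fun _ => 0, 0)).hasFDerivAt).comp_hasDerivAt (0 : ℝ)
        ((hasDerivAt_id _).prodMk
          ((hasDerivAt_pi.2 fun _ => hasDerivAt_id _).prodMk (hasDerivAt_const _ _)))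
    simp only [h1'] at h3
    have h4 := h2.unique h3
    rw [one_mul] at h4
    rw [h4]
    have h5 : ((1, fun _ => 1, 0) : ℝ × (Fin k → ℝ) × ℝ) =
        cellDir k + ∑ i, (1 : ℝ) • inputDir i := by
      rw [← input_vector_eq_sum (fun _ => 1)]
      simp [cellDir]
    rw [h5, map_add, hcell, zero_add, map_sum]
    simpa using hsum
  have ht : Tendsto (fun t : ℝ => ε * t) (𝓝[>] 0) (𝓝 0) :=
    (by fun_prop : Continuous fun t : ℝ => ε * t).tendsto' 0 0 (by simp)
      |>.mono_left nhdsWithin_le_nhds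
  have h6 : Tendsto (fun t => H₁ (x t, ε * t)) (𝓝[>] 0) (𝓝 (H₁ (0, 0))) :=
    (hH₁.continuous.tendsto _).comp (hx.prodMk_nhds ht)
  filter_upwards [heq, h6.eventually_ne hH0] with t h7 h8
  rw [h1'] at h7
  exact (mul_eq_zero.1 h7).resolve_right h8

/-- A cell all of whose inputs vanish undergoes a transcritical bifurcation: its state vanishes or
follows the unique nontrivial branch, which is smooth. -/
theorem zero_or_rootGerm_of_zero_inputs {k : ℕ} {F : ℝ × (Fin k → ℝ) × ℝ → ℝ}
    (hF : ContDiff ℝ ∞ F) (htriv : ∀ μ, F (0, 0, μ) = 0)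
    (hcell : fderiv ℝ F 0 (cellDir k) = 0)
    (hq : fderiv ℝ (fderiv ℝ F) 0 (cellDir k) (cellDir k) ≠ 0)
    (hl : fderiv ℝ (fderiv ℝ F) 0 (paramDir k) (cellDir k) ≠ 0)
    {ε : ℝ} (hε : ε ≠ 0) {x : ℝ → ℝ} (hxc : ∀ᶠ t in 𝓝[>] 0, ContinuousAt x t)
    (hx : Tendsto x (𝓝[>] 0) (𝓝 0)) (heq : ∀ᶠ t in 𝓝[>] 0, F (x t, 0, ε * t) = 0) :
    (∀ᶠ t in 𝓝[>] 0, x t = 0) ∨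
      RootGerm x 0 (ε * (-2 * fderiv ℝ (fderiv ℝ F) 0 (paramDir k) (cellDir k) /
        fderiv ℝ (fderiv ℝ F) 0 (cellDir k) (cellDir k))) := by
  obtain ⟨G, F₂, hG, hF₂, hexp, hGF, hF₂0⟩ := exists_smooth_quadratic_expansion hF
  change 2 * F₂ 0 = fderiv ℝ (fderiv ℝ F) 0 (cellDir k) (cellDir k) at hF₂0
  change ∀ z, G z = fderiv ℝ F (0, z) (cellDir k) at hGF
  set q := fderiv ℝ (fderiv ℝ F) 0 (cellDir k) (cellDir k)
  set l := fderiv ℝ (fderiv ℝ F) 0 (paramDir k) (cellDir k) with hldef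
  have hF' : ContDiff ℝ ∞ (fderiv ℝ F) := hF.fderiv_right (m := ∞) (by simp)
  have hF₂ne : F₂ 0 ≠ 0 := by
    intro h
    rw [h, mul_zero] at hF₂0
    exact hq hF₂0.symm
  -- the equation is `x * K (t, x) = 0`
  let K : ℝ × ℝ → ℝ := fun p => G (0, ε * p.1) + p.2 * F₂ (p.2, 0, ε * p.1)
  have hK : ContDiff ℝ ∞ K :=
    (hG.comp (by fun_prop)).add (contDiff_snd.mul (hF₂.comp (by fun_prop)))
  have hFK : ∀ t x, F (x, 0, ε * t) = x * K (t, x) := by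
    intro t x
    rw [hexp, htriv, zero_add]
  have hG0 : G 0 = 0 := by
    rw [hGF]
    exact hcell
  have hK0 : K 0 = 0 := by
    change G (0, ε * 0) + 0 * _ = 0
    rw [mul_zero, zero_mul, add_zero]
    exact hG0
  have hKd : HasDerivAt (fun x => K (0, x)) (F₂ 0) 0 := by
    have hc : ContinuousAt (fun x : ℝ => F₂ (x, 0, ε * 0)) 0 :=
      (hF₂.continuous.comp (by fun_prop)).continuousAt
    have h2 := ((hasDerivAt_id (0 : ℝ)).mul_continuousAt_of_eq_zero rfl hc).const_add
      (G (0, ε * 0))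
    rw [one_mul, mul_zero] at h2
    simp only [K, mul_zero]
    exact h2
  obtain ⟨φ, hφ, hφ0, hiff⟩ := exists_smooth_implicit (Eventually.of_forall fun p =>
    hK.contDiffAt) hK0 hKd hF₂ne
  have hφder : HasDerivAt φ (ε * (-2 * l / q)) 0 := by
    have hφd : HasDerivAt φ (deriv φ 0) 0 := (hφ.differentiable (by simp) 0).hasDerivAt
    have hc : ContinuousAt (fun t : ℝ => F₂ (φ t, 0, ε * t)) 0 := by
      have := hφ.continuous
      exact (hF₂.continuous.comp (by fun_prop)).continuousAt
    have h3 : HasDerivAt (fun t : ℝ => G (0, ε * t)) (ε * l) 0 := by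
      have h4 : HasDerivAt (fun t : ℝ => fderiv ℝ F (0, 0, ε * t))
          (fderiv ℝ (fderiv ℝ F) 0 (ε • paramDir k)) 0 := by
        have h5 : HasDerivAt (fun t : ℝ => ((0, 0, ε * t) : ℝ × (Fin k → ℝ) × ℝ))
            (ε • paramDir k) 0 := by
          have : (ε • paramDir k) = (0, 0, ε * 1) := by simp [paramDir]
          rw [this]
          exact (hasDerivAt_const _ _).prodMk
            ((hasDerivAt_const _ _).prodMk ((hasDerivAt_id (0 : ℝ)).const_mul ε))
        have h6 : HasFDerivAt (fderiv ℝ F) (fderiv ℝ (fderiv ℝ F) 0) (0, 0, ε * 0) := by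
          rw [mul_zero]
          exact (hF'.differentiable (by simp) 0).hasFDerivAt
        exact h6.comp_hasDerivAt (0 : ℝ) h5
      have h7 := h4.clm_apply (hasDerivAt_const (0 : ℝ) (cellDir k))
      simpa [hGF, hldef] using h7
    have h8 := h3.add (hφd.mul_continuousAt_of_eq_zero hφ0 hc)
    have hgraph : Tendsto (fun t => (t, φ t)) (𝓝 0) (𝓝 (0 : ℝ × ℝ)) :=
      (continuous_id.prodMk hφ.continuous).tendsto' _ _ (by simp [hφ0])
    have h9 : ∀ᶠ t in 𝓝 (0 : ℝ), K (t, φ t) = 0 := by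
      filter_upwards [hgraph.eventually hiff] with t ht using ht.2 rfl
    have h10 := h8.unique ((hasDerivAt_const (0 : ℝ) (0 : ℝ)).congr_of_eventuallyEq h9)
    have h11 : F₂ (φ 0, 0, ε * 0) = q / 2 := by
      rw [hφ0, mul_zero]
      change F₂ 0 = q / 2
      linarith
    rw [h11] at h10
    have h12 : deriv φ 0 = ε * (-2 * l / q) := by
      field_simp
      linarith
    rwa [← h12]
  have hd0 : ε * (-2 * l / q) ≠ 0 := mul_ne_zero hε (div_ne_zero (mul_ne_zero (by simp) hl) hq)
  have hφne : ∀ᶠ t in 𝓝[>] 0, φ t ≠ 0 := by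
    have := hφder.eventually_ne (c := 0) hd0
    exact this.filter_mono (nhdsWithin_mono (0 : ℝ) fun x hx => (ne_of_gt hx : x ≠ 0))
  have hpair : Tendsto (fun t => (t, x t)) (𝓝[>] 0) (𝓝 (0 : ℝ × ℝ)) :=
    (tendsto_id.mono_left nhdsWithin_le_nhds).prodMk_nhds hx
  have hor : ∀ᶠ t in 𝓝[>] 0, x t = 0 ∨ x t = φ t := by
    filter_upwards [heq, hpair.eventually hiff] with t h1 h2
    rw [hFK] at h1
    exact (mul_eq_zero.1 h1).imp_right fun h => (h2.1 h).symm
  -- the quotient `x / φ` only takes the values `0` and `1`, hence is constant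
  have hcu : ∀ᶠ t in 𝓝[>] 0, ContinuousAt (fun t => x t / φ t - 1 / 2) t := by
    filter_upwards [hxc, hφne] with t h1 h2
    exact (h1.div hφ.continuous.continuousAt h2).sub continuousAt_const
  have hu0 : ∀ᶠ t in 𝓝[>] (0 : ℝ), x t / φ t - 1 / 2 ≠ 0 := by
    filter_upwards [hor, hφne] with t h1 h2
    rcases h1 with h1 | h1 <;> rw [h1]
    · norm_num
    · rw [div_self h2]
      norm_num
  rcases eventually_pos_or_neg hcu hu0 with h | h
  · refine Or.inr ⟨φ, hφ, hφ0, hφder, ?_⟩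
    filter_upwards [h, hor] with t h1 h2
    rw [dyadicRoot_zero]
    refine h2.resolve_left fun h3 => ?_
    rw [h3] at h1
    norm_num at h1
  · refine Or.inl ?_
    filter_upwards [h, hor, hφne] with t h1 h2 h3
    refine h2.resolve_right fun h4 => ?_
    rw [h4, div_self h3] at h1
    norm_num at h1

/-- A cell whose inputs grow like the `2 ^ n`-th root, to leading order, undergoes a fold
bifurcation with respect to this root of the parameter. -/
theorem rootGerm_succ_of_inputs {k : ℕ} {F : ℝ × (Fin k → ℝ) × ℝ → ℝ}
    (hF : ContDiff ℝ ∞ F) (htriv : ∀ μ, F (0, 0, μ) = 0)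
    (hcell : fderiv ℝ F 0 (cellDir k) = 0)
    (hq : fderiv ℝ (fderiv ℝ F) 0 (cellDir k) (cellDir k) ≠ 0)
    {ε : ℝ} {x : ℝ → ℝ} (hxc : ∀ᶠ t in 𝓝[>] 0, ContinuousAt x t)
    (hx : Tendsto x (𝓝[>] 0) (𝓝 0)) {n : ℕ} {y : Fin k → ℝ → ℝ} {s : Fin k → ℝ}
    (hy : ∀ i, RootGerm (y i) n (s i)) (hA : ∑ i, fderiv ℝ F 0 (inputDir i) * s i ≠ 0)
    (heq : ∀ᶠ t in 𝓝[>] 0, F (x t, fun i => y i t, ε * t) = 0) :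
    ∃ d, d ^ 2 = -(2 / fderiv ℝ (fderiv ℝ F) 0 (cellDir k) (cellDir k) *
        ∑ i, fderiv ℝ F 0 (inputDir i) * s i) ∧ RootGerm x (n + 1) d := by
  obtain ⟨G, F₂, hG, hF₂, hexp, hGF, hF₂0⟩ := exists_smooth_quadratic_expansion hF
  change 2 * F₂ 0 = fderiv ℝ (fderiv ℝ F) 0 (cellDir k) (cellDir k) at hF₂0
  change ∀ z, G z = fderiv ℝ F (0, z) (cellDir k) at hGF
  set q := fderiv ℝ (fderiv ℝ F) 0 (cellDir k) (cellDir k)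
  set A := ∑ i, fderiv ℝ F 0 (inputDir i) * s i with hAdef
  choose g hg hg0 hgd hgy using hy
  -- inputs and parameter as a smooth function of `u`, the `2 ^ n`-th root of `t`
  let z : ℝ → (Fin k → ℝ) × ℝ := fun u => (fun i => g i u, ε * u ^ 2 ^ n)
  have hz : ContDiff ℝ ∞ z :=
    (contDiff_pi.2 fun i => hg i).prodMk (contDiff_const.mul (contDiff_id.pow _))
  have hz0 : z 0 = 0 := by
    have : (fun i => g i 0) = 0 := funext hg0
    simp [z, this]
  obtain ⟨c, hzd⟩ : ∃ c, HasDerivAt z (s, c) 0 :=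
    ⟨_, (hasDerivAt_pi.2 hgd).prodMk ((hasDerivAt_pow (2 ^ n) (0 : ℝ)).const_mul ε)⟩
  have hzF : HasDerivAt (fun u => F (0, z u)) A 0 := by
    have h1 : HasFDerivAt F (fderiv ℝ F 0) (0, z 0) := by
      rw [hz0]
      exact (hF.differentiable (by simp) 0).hasFDerivAt
    have h2 := h1.comp_hasDerivAt (0 : ℝ) ((hasDerivAt_const (0 : ℝ) (0 : ℝ)).prodMk hzd)
    have h3 : ((0, s, c) : ℝ × (Fin k → ℝ) × ℝ) = (0, s, 0) + c • paramDir k := by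
      simp [paramDir]
    rw [h3, input_vector_eq_sum, map_add, map_sum, map_smul, fderiv_paramDir hF htriv,
      smul_zero, add_zero] at h2
    simpa [hAdef, mul_comm, Function.comp_def] using h2
  have hGz : ContDiff ℝ ∞ fun u => G (z u) := hG.comp hz
  obtain ⟨α, hα, hα0, hαF⟩ := exists_smooth_eq_mul (hF.comp (contDiff_const.prodMk hz))
    (by rw [Function.comp_apply, hz0]; exact htriv 0) hzF
  obtain ⟨γ, hγ, -, hγG⟩ := exists_smooth_eq_mul hGz
    (by rw [hz0, hGF]; exact hcell) (hGz.differentiable (by simp) 0).hasDerivAt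
  -- the equation of the cell is `u = x ^ 2 * N (u, x)`
  let den : ℝ × ℝ → ℝ := fun p => α p.1 + p.2 * γ p.1
  let N : ℝ × ℝ → ℝ := fun p => -F₂ (p.2, z p.1) / den p
  have hden : ContDiff ℝ ∞ den :=
    (hα.comp contDiff_fst).add (contDiff_snd.mul (hγ.comp contDiff_fst))
  have hden0 : den 0 = A := by simp [den, hα0]
  have hdenne : ∀ᶠ p in 𝓝 (0 : ℝ × ℝ), den p ≠ 0 :=
    hden.continuous.continuousAt.eventually_ne (by rwa [hden0])
  have hNs : ∀ᶠ p in 𝓝 (0 : ℝ × ℝ), ContDiffAt ℝ ∞ N p := by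
    filter_upwards [hdenne] with p hp
    exact ((hF₂.comp (contDiff_snd.prodMk (hz.comp contDiff_fst))).neg.contDiffAt).div
      hden.contDiffAt hp
  have hN0 : N 0 = -(q / 2) / A := by
    have : F₂ (0, z 0) = q / 2 := by
      rw [hz0]
      change F₂ 0 = q / 2
      linarith
    simp only [N, hden0, Prod.fst_zero, Prod.snd_zero, this]
  have hN0ne : N 0 ≠ 0 := by
    rw [hN0]
    exact div_ne_zero (neg_ne_zero.2 (div_ne_zero hq two_ne_zero)) hA
  have hNc : ContinuousAt N 0 := hNs.self_of_nhds.continuousAt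
  have hroot : Tendsto (dyadicRoot n) (𝓝[>] 0) (𝓝 0) :=
    (tendsto_dyadicRoot n).mono_right nhdsWithin_le_nhds
  have hpair : Tendsto (fun t => (dyadicRoot n t, x t)) (𝓝[>] 0) (𝓝 (0 : ℝ × ℝ)) :=
    hroot.prodMk_nhds hx
  have hN : ∀ᶠ t in 𝓝[>] 0, dyadicRoot n t = x t ^ 2 * N (dyadicRoot n t, x t) := by
    filter_upwards [heq, hpair.eventually hdenne, eventually_all.2 hgy,
      self_mem_nhdsWithin] with t h1 h2 h3 h4
    have h5 : ((fun i => y i t, ε * t) : (Fin k → ℝ) × ℝ) = z (dyadicRoot n t) := by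
      simp only [z, dyadicRoot_pow n h4]
      congr 1
      exact funext h3
    have h6 := hαF (dyadicRoot n t)
    simp only [Function.comp_def] at h6
    rw [h5, hexp, h6, hγG] at h1
    simp only [N]
    rw [mul_div_assoc', eq_div_iff h2]
    simp only [den]
    linear_combination h1
  have hupos : ∀ᶠ t in 𝓝[>] (0 : ℝ), 0 < dyadicRoot n t := by
    filter_upwards [self_mem_nhdsWithin] with t ht using dyadicRoot_pos n ht
  have hNpos : 0 < N 0 := by
    by_contra hneg
    have hlt : N 0 < 0 := lt_of_le_of_ne (not_lt.1 hneg) hN0ne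
    have h1 : ∀ᶠ t in 𝓝[>] (0 : ℝ), False := by
      filter_upwards [hN, hupos, hpair.eventually (hNc.eventually_lt continuousAt_const hlt)]
        with t h1 h2 h3
      nlinarith [sq_nonneg (x t)]
    exact h1.exists.elim fun _ h => h
  -- extracting the square root of the equation leaves a regular equation for `x`
  let sq : ℝ × ℝ → ℝ × ℝ := fun p => (p.1 ^ 2, p.2)
  have hsq : ContDiff ℝ ∞ sq := (contDiff_fst.pow 2).prodMk contDiff_snd
  have hsq0 : Tendsto sq (𝓝 0) (𝓝 0) := hsq.continuous.tendsto' _ _ (by simp [sq])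
  have hNpos' : ∀ᶠ p in 𝓝 (0 : ℝ × ℝ), 0 < N p := continuousAt_const.eventually_lt hNc hNpos
  let R : ℝ × ℝ → ℝ := fun p => √(N (sq p))
  have hR : ∀ᶠ p in 𝓝 (0 : ℝ × ℝ), ContDiffAt ℝ ∞ R p := by
    filter_upwards [hsq0.eventually hNs, hsq0.eventually hNpos'] with p h1 h2
    exact (h1.comp p hsq.contDiffAt).sqrt h2.ne'
  have hRc : ContinuousAt R 0 := hR.self_of_nhds.continuousAt
  have hR0 : R 0 = √(N 0) := by simp only [R, sq]; congr 2; simp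
  let K : ℝ × ℝ → ℝ := fun p => p.2 * R p - p.1
  have hK : ∀ᶠ p in 𝓝 (0 : ℝ × ℝ), ContDiffAt ℝ ∞ K p := by
    filter_upwards [hR] with p hp
    exact (contDiffAt_snd.mul hp).sub contDiffAt_fst
  have hKd : HasDerivAt (fun x => K (0, x)) (√(N 0)) 0 := by
    have hc : ContinuousAt (fun x : ℝ => R (0, x)) 0 :=
      ContinuousAt.comp (f := fun x : ℝ => ((0 : ℝ), x)) (g := R) hRc (by fun_prop)
    have h1 := (hasDerivAt_id (0 : ℝ)).mul_continuousAt_of_eq_zero rfl hc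
    rw [one_mul] at h1
    change HasDerivAt _ (R 0) 0 at h1
    rw [hR0] at h1
    simpa [K] using h1
  obtain ⟨φ, hφ, hφ0, hiff⟩ := exists_smooth_implicit hK (by simp [K]) hKd
    (Real.sqrt_pos.2 hNpos).ne'
  have hφd : HasDerivAt φ (deriv φ 0) 0 := (hφ.differentiable (by simp) 0).hasDerivAt
  have hφ2 : deriv φ 0 ^ 2 = -(2 / q * A) := by
    have hgraph : Tendsto (fun τ => (τ, φ τ)) (𝓝 0) (𝓝 (0 : ℝ × ℝ)) :=
      (continuous_id.prodMk hφ.continuous).tendsto' _ _ (by simp [hφ0])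
    have hc : ContinuousAt (fun τ => R (τ, φ τ)) 0 := by
      refine ContinuousAt.comp (f := fun τ : ℝ => (τ, φ τ)) (g := R) ?_
        (continuous_id.prodMk hφ.continuous).continuousAt
      rw [hφ0]
      exact hRc
    have h1 := hφd.mul_continuousAt_of_eq_zero hφ0 hc
    have h2 : ∀ᶠ τ in 𝓝 (0 : ℝ), φ τ * R (τ, φ τ) = τ := by
      filter_upwards [hgraph.eventually hiff] with τ h3
      exact sub_eq_zero.1 (h3.2 rfl)
    have h3 := h1.unique ((hasDerivAt_id (0 : ℝ)).congr_of_eventuallyEq h2)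
    rw [hφ0] at h3
    change deriv φ 0 * R 0 = 1 at h3
    rw [hR0] at h3
    have h4 : deriv φ 0 ^ 2 * N 0 = 1 := by
      rw [← Real.sq_sqrt hNpos.le, ← mul_pow, h3, one_pow]
    rw [hN0] at h4
    field_simp at h4 ⊢
    linarith
  have hxne : ∀ᶠ t in 𝓝[>] (0 : ℝ), x t ≠ 0 := by
    filter_upwards [hN, hupos] with t h1 h2 h3
    rw [h1, h3] at h2
    simp at h2
  have hτ : Tendsto (dyadicRoot (n + 1)) (𝓝[>] 0) (𝓝 0) :=
    (tendsto_dyadicRoot (n + 1)).mono_right nhdsWithin_le_nhds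
  rcases eventually_pos_or_neg hxc hxne with hpos | hneg
  · refine ⟨deriv φ 0, hφ2, φ, hφ, hφ0, hφd, ?_⟩
    filter_upwards [hpos, hN, hpair.eventually hNpos', (hτ.prodMk_nhds hx).eventually hiff,
      self_mem_nhdsWithin] with t h1 h2 h3 h4 h5
    refine (h4.1 (sub_eq_zero.2 ?_)).symm
    have h6 := dyadicRoot_pos (n + 1) h5
    simp only [R, sq, dyadicRoot_succ_sq n h5]
    rw [← sq_eq_sq₀ (mul_nonneg h1.le (Real.sqrt_nonneg _)) h6.le, mul_pow,
      Real.sq_sqrt h3.le, dyadicRoot_succ_sq n h5]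
    exact h2.symm
  · refine ⟨-deriv φ 0, by rw [neg_sq]; exact hφ2, fun τ => φ (-τ), hφ.comp contDiff_neg,
      by simp [hφ0], ?_, ?_⟩
    · have h1 : HasDerivAt φ (deriv φ 0) (-0) := by rwa [neg_zero]
      have h2 := h1.comp (0 : ℝ) (hasDerivAt_neg 0)
      rwa [mul_neg_one] at h2
    · have hτ' : Tendsto (fun t => -dyadicRoot (n + 1) t) (𝓝[>] 0) (𝓝 0) := by
        simpa using hτ.neg
      filter_upwards [hneg, hN, hpair.eventually hNpos', (hτ'.prodMk_nhds hx).eventually hiff,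
        self_mem_nhdsWithin] with t h1 h2 h3 h4 h5
      refine (h4.1 (sub_eq_zero.2 ?_)).symm
      have h6 := dyadicRoot_pos (n + 1) h5
      simp only [R, sq, neg_sq, dyadicRoot_succ_sq n h5]
      rw [eq_neg_iff_add_eq_zero, add_comm, ← eq_neg_iff_add_eq_zero, ← neg_mul,
        ← sq_eq_sq₀ h6.le (mul_nonneg (neg_nonneg.2 h1.le) (Real.sqrt_nonneg _)), mul_pow,
        Real.sq_sqrt h3.le, dyadicRoot_succ_sq n h5, neg_sq]
      exact h2

/-! ### Leading coefficients and their generic nonvanishing -/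

/-- The part of the jet of `f` on which leading coefficients depend: the derivatives in the
directions of the inputs, the second derivative `∂²f/∂x₀²` and the mixed derivative `∂²f/∂x₀∂μ`. -/
abbrev JetCoeffs (k : ℕ) := (Fin k → ℝ) × ℝ × ℝ

/-- Assignments of a member of `L` or of `0` to every input, not all of them being `0`. -/
def inputChoices {k : ℕ} (L : Set (JetCoeffs k → ℝ)) : Set (Fin k → JetCoeffs k → ℝ) :=
  {ch | (∀ i, ch i ∈ insert 0 L) ∧ ∃ i, ch i ∈ L}

/-- The leading coefficient of the sum of the inputs. -/
def inputSum {k : ℕ} (ch : Fin k → JetCoeffs k → ℝ) (θ : JetCoeffs k) : ℝ :=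
  ∑ i, θ.1 i * ch i θ

/-- The possible leading coefficients of a state that grows like the `2 ^ n`-th root of `|μ|`, as
functions of the jet. A state exists only where `2 / q * inputSum ch θ` is negative; the absolute
value yields a continuous function for both signs. -/
def leadFuns (k : ℕ) : ℕ → Set (JetCoeffs k → ℝ)
  | 0 => {fun θ => -2 * θ.2.2 / θ.2.1, fun θ => -(-2 * θ.2.2 / θ.2.1)}
  | n + 1 => ⋃ ch ∈ inputChoices (leadFuns k n),
      {fun θ => √|2 / θ.2.1 * inputSum ch θ|, fun θ => -√|2 / θ.2.1 * inputSum ch θ|}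

/-- The jets for which no leading coefficient vanishes up to the `2 ^ m`-th root. -/
def nondegenerateJets (k m : ℕ) : Set (JetCoeffs k) :=
  {θ | θ.2.1 ≠ 0 ∧ θ.2.2 ≠ 0 ∧ ∀ n ≤ m, ∀ ch ∈ inputChoices (leadFuns k n), inputSum ch θ ≠ 0}

theorem finite_inputChoices {k : ℕ} {L : Set (JetCoeffs k → ℝ)} (hL : L.Finite) :
    (inputChoices L).Finite := by
  refine (Set.Finite.pi (t := fun _ : Fin k => insert 0 L) fun _ => hL.insert 0).subset ?_
  exact fun ch hch i _ => hch.1 i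

theorem finite_leadFuns (k n : ℕ) : (leadFuns k n).Finite := by
  induction n with
  | zero => exact (Set.finite_singleton _).insert _
  | succ n ih => exact (finite_inputChoices ih).biUnion fun ch _ =>
      (Set.finite_singleton _).insert _

theorem continuousOn_inputSum {k : ℕ} {L : Set (JetCoeffs k → ℝ)} {U : Set (JetCoeffs k)}
    (hL : ∀ φ ∈ L, ContinuousOn φ U) {ch : Fin k → JetCoeffs k → ℝ} (hch : ch ∈ inputChoices L) :
    ContinuousOn (inputSum ch) U := by
  refine continuousOn_finsetSum _ fun i _ => ContinuousOn.mul (by fun_prop) ?_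
  rcases hch.1 i with h | h
  · rw [h]
    exact continuousOn_const
  · exact hL _ h

theorem continuousOn_leadFuns (k n : ℕ) :
    ∀ φ ∈ leadFuns k n, ContinuousOn φ {θ | θ.2.1 ≠ 0} := by
  induction n with
  | zero =>
    have h : ContinuousOn (fun θ : JetCoeffs k => -2 * θ.2.2 / θ.2.1) {θ | θ.2.1 ≠ 0} :=
      ContinuousOn.div (by fun_prop) (by fun_prop) fun θ hθ => hθ
    rintro φ (rfl | rfl)
    · exact h
    · exact h.neg
  | succ n ih =>
    intro φ hφ
    simp only [leadFuns, mem_iUnion] at hφ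
    obtain ⟨ch, hch, hφ⟩ := hφ
    have h1 : ContinuousOn (fun θ : JetCoeffs k => 2 / θ.2.1) {θ | θ.2.1 ≠ 0} :=
      ContinuousOn.div (by fun_prop) (by fun_prop) fun θ hθ => hθ
    have h : ContinuousOn (fun θ : JetCoeffs k => √|2 / θ.2.1 * inputSum ch θ|)
        {θ | θ.2.1 ≠ 0} := (h1.mul (continuousOn_inputSum ih hch)).abs.sqrt
    rcases hφ with rfl | rfl
    · exact h
    · exact h.neg

theorem isOpen_nondegenerateJets (k m : ℕ) : IsOpen (nondegenerateJets k m) := by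
  have hU : IsOpen {θ : JetCoeffs k | θ.2.1 ≠ 0} :=
    isOpen_ne.preimage (by fun_prop : Continuous fun θ : JetCoeffs k => θ.2.1)
  have hV : IsOpen {θ : JetCoeffs k | θ.2.2 ≠ 0} :=
    isOpen_ne.preimage (by fun_prop : Continuous fun θ : JetCoeffs k => θ.2.2)
  have hW : IsOpen (⋂ n ∈ Iic m, ⋂ ch ∈ inputChoices (leadFuns k n),
      {θ : JetCoeffs k | θ.2.1 ≠ 0} ∩ inputSum ch ⁻¹' {0}ᶜ) :=
    (Set.finite_Iic m).isOpen_biInter fun n _ =>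
      (finite_inputChoices (finite_leadFuns k n)).isOpen_biInter fun ch hch =>
        (continuousOn_inputSum (continuousOn_leadFuns k n) hch).isOpen_inter_preimage hU
          isOpen_compl_singleton
  convert (hU.inter hV).inter hW using 1
  ext θ
  simp only [nondegenerateJets, mem_ofPred_eq, mem_inter_iff, mem_iInter, mem_Iic, mem_preimage,
    mem_compl_iff, mem_singleton_iff]
  constructor
  · rintro ⟨h1, h2, h3⟩
    exact ⟨⟨h1, h2⟩, fun n hn ch hch => ⟨h1, h3 n hn ch hch⟩⟩
  · rintro ⟨⟨h1, h2⟩, h3⟩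
    exact ⟨h1, h2, fun n hn ch hch => (h3 n hn ch hch).2⟩

/-- At a nondegenerate jet the leading coefficients do not vanish. -/
theorem leadFuns_ne_zero {k m : ℕ} {θ : JetCoeffs k} (hθ : θ ∈ nondegenerateJets k m) {n : ℕ}
    (hn : n ≤ m + 1) {φ : JetCoeffs k → ℝ} (hφ : φ ∈ leadFuns k n) : φ θ ≠ 0 := by
  obtain ⟨hq, hl, hsum⟩ := hθ
  cases n with
  | zero =>
    rcases hφ with rfl | rfl
    · exact div_ne_zero (mul_ne_zero (by simp) hl) hq
    · exact neg_ne_zero.2 (div_ne_zero (mul_ne_zero (by simp) hl) hq)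
  | succ n =>
    simp only [leadFuns, mem_iUnion] at hφ
    obtain ⟨ch, hch, hφ⟩ := hφ
    have h : √|2 / θ.2.1 * inputSum ch θ| ≠ 0 := (Real.sqrt_pos.2 (abs_pos.2
      (mul_ne_zero (div_ne_zero two_ne_zero hq) (hsum n (by omega) ch hch)))).ne'
    rcases hφ with rfl | rfl
    · exact h
    · exact neg_ne_zero.2 h

/-- The `2`-adic valuation of `ℚ` extends to a valuation of the field `ℝ`. -/
theorem exists_dyadic_valuationSubring :
    ∃ A : ValuationSubring ℝ, A.valuation 2 < 1 ∧ ∀ n : ℤ, A.valuation (2 * n + 1) = 1 := by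
  let R : Subring ℝ := (Int.castRingHom ℝ).range
  let two : R := ⟨2, 2, by simp⟩
  have hI : Ideal.span {two} ≠ ⊤ := by
    rw [Ne, Ideal.span_singleton_eq_top]
    intro h
    obtain ⟨⟨y, n, rfl⟩, hy⟩ := h.exists_right_inv
    have h1 : (2 : ℝ) * (n : ℝ) = 1 := congrArg Subtype.val hy
    have h2 : 2 * n = 1 := by exact_mod_cast h1
    omega
  obtain ⟨B, hB, hIB⟩ := Ideal.image_subset_nonunits_valuationSubring _ hI
  have h2 : B.valuation 2 < 1 := by
    have : (2 : ℝ) ∈ B.nonunits := hIB ⟨two, Ideal.subset_span rfl, rfl⟩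
    exact this
  refine ⟨B, h2, fun n => ?_⟩
  have hn : B.valuation (n : ℝ) ≤ 1 := (B.valuation_le_one_iff _).2 (hB ⟨n, rfl⟩)
  rw [add_comm]
  refine Valuation.map_one_add_of_lt _ ?_
  rw [map_mul]
  exact mul_lt_one_of_lt_of_le h2 hn

/-- For an extension of the `2`-adic valuation to `ℝ`, the reals with the valuation of `2 ^ w` are
dense. -/
theorem dense_valuation_eq {A : ValuationSubring ℝ}
    (hA : ∀ n : ℤ, A.valuation (2 * n + 1) = 1) (w : ℕ) :
    Dense {x : ℝ | A.valuation x = A.valuation 2 ^ w} := by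
  rw [Metric.dense_iff]
  intro y δ hδ
  obtain ⟨s, hs⟩ := exists_nat_gt ((2 : ℝ) ^ w / δ)
  set M : ℝ := 2 * (s : ℤ) + 1 with hM
  have hs0 : (0 : ℝ) ≤ s := Nat.cast_nonneg s
  have hMs : (s : ℝ) < M := by rw [hM]; push_cast; linarith
  have hMpos : 0 < M := hs0.trans_lt hMs
  have hw : (0 : ℝ) < 2 ^ w := by positivity
  set n : ℤ := ⌊y * M / (2 ^ w * 2)⌋ with hn
  refine ⟨2 ^ w * ((2 * n + 1) / M), ?_, ?_⟩
  · have h1 : (n : ℝ) ≤ y * M / (2 ^ w * 2) := Int.floor_le _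
    have h2 : y * M / (2 ^ w * 2) < n + 1 := Int.lt_floor_add_one _
    rw [le_div_iff₀ (by positivity)] at h1
    rw [div_lt_iff₀ (by positivity)] at h2
    have h3 : (2 : ℝ) ^ w / M < δ := by
      rw [div_lt_iff₀ hMpos]
      rw [div_lt_iff₀ hδ] at hs
      nlinarith
    have h4 : (2 : ℝ) ^ w * ((2 * n + 1) / M) - y = (2 ^ w * (2 * n + 1) - y * M) / M := by
      field_simp
    rw [Metric.mem_ball, Real.dist_eq, h4, abs_div, abs_of_pos hMpos]
    refine lt_of_le_of_lt (div_le_div_of_nonneg_right ?_ hMpos.le) h3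
    rw [abs_le]
    constructor <;> linarith
  · change A.valuation _ = _
    rw [map_mul, map_pow, map_div₀, hA, hM, hA, div_one, mul_one]

/-- Uniqueness of digits. -/
theorem eq_of_sum_mul_pow_eq {k B : ℕ} {c c' : Fin k → ℕ} (hc : ∀ j, c j < B)
    (hc' : ∀ j, c' j < B) (h : ∑ j, c j * B ^ (j : ℕ) = ∑ j, c' j * B ^ (j : ℕ)) : c = c' := by
  have h1 : (fun j => (⟨c j, hc j⟩ : Fin B)) = fun j => ⟨c' j, hc' j⟩ := by
    apply finFunctionFinEquiv.injective
    ext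
    rw [finFunctionFinEquiv_apply, finFunctionFinEquiv_apply]
    exact h
  funext j
  exact congrArg Fin.val (congrFun h1 j)

/-- If the `M`-th powers of the valuations of the terms are powers of that of `2`, and the digit
`i` of the exponent is at least `M` for the term `i` only, then one term strictly dominates all the
others. -/
theorem exists_valuation_sum_eq {k B M : ℕ} {A : ValuationSubring ℝ} (h0 : A.valuation 2 < 1)
    {S : Finset (Fin k)} (hS : S.Nonempty) {x : Fin k → ℝ}
    {c : Fin k → Fin k → ℕ} (hMB : 2 * M ≤ B) (hc : ∀ i j, c i j < M)
    (hx : ∀ i ∈ S, A.valuation (x i) ^ M =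
      A.valuation 2 ^ ∑ j, (c i j + if j = i then M else 0) * B ^ (j : ℕ)) :
    ∃ i ∈ S, A.valuation (∑ i ∈ S, x i) = A.valuation (x i) := by
  obtain ⟨i, hi, hmax⟩ := S.exists_max_image (fun i => A.valuation (x i)) hS
  refine ⟨i, hi, Valuation.map_sum_eq_of_lt _ hi fun j hj => ?_⟩
  rw [Finset.mem_sdiff, Finset.mem_singleton] at hj
  refine lt_of_le_of_ne (hmax j hj.1) fun heq => ?_
  have h2 : (0 : A.ValueGroup) < A.valuation 2 :=
    zero_lt_iff.2 ((Valuation.ne_zero_iff _).2 two_ne_zero)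
  have h3 := hx j hj.1
  rw [heq, hx i hi] at h3
  have hlt : ∀ i j, (c i j + if j = i then M else 0) < B := fun i j => by
    have := hc i j
    split_ifs <;> omega
  have h4 := congrFun (eq_of_sum_mul_pow_eq (hlt i) (hlt j)
    ((pow_right_strictAnti₀ h2 h0).injective h3)) j
  rw [if_pos rfl, if_neg hj.2] at h4
  have := hc i j
  omega

theorem valuation_abs (A : ValuationSubring ℝ) (x : ℝ) : A.valuation |x| = A.valuation x := by
  rcases abs_choice x with h | h <;> rw [h]
  exact Valuation.map_neg _ _

/-- If the valuations of the coefficients are very different powers of `2`, then the terms of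
`inputSum` have different valuations, so that they cannot cancel. -/
theorem mem_nondegenerateJets_of_valuation {k m : ℕ} {A : ValuationSubring ℝ}
    (h2 : A.valuation 2 < 1) {θ : JetCoeffs k}
    (ha : ∀ i, A.valuation (θ.1 i) = A.valuation 2 ^ (2 ^ (m + 1)) ^ (i : ℕ))
    (hq : A.valuation θ.2.1 = A.valuation 2 ^ 1) (hl : A.valuation θ.2.2 = A.valuation 2 ^ 0) :
    θ ∈ nondegenerateJets k m := by
  classical
  set B : ℕ := 2 ^ (m + 1) with hB
  have hγ : A.valuation 2 ≠ 0 := (Valuation.ne_zero_iff _).2 two_ne_zero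
  rw [pow_one] at hq
  rw [pow_zero] at hl
  have hκ : A.valuation (2 / θ.2.1) = 1 := by rw [map_div₀, hq, div_self hγ]
  -- The exponent of `v (φ θ) ^ 2 ^ n` has digits less than `2 ^ n` in base `B`, for `φ` in
  -- `leadFuns k n`. The factor `θ.1 i` adds `2 ^ n` to the digit `i`.
  have hstep : ∀ n ≤ m, (∀ φ ∈ leadFuns k n, ∃ c : Fin k → ℕ, (∀ j, c j < 2 ^ n) ∧
      A.valuation (φ θ) ^ 2 ^ n = A.valuation 2 ^ ∑ j, c j * B ^ (j : ℕ)) →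
      ∀ ch ∈ inputChoices (leadFuns k n), ∃ c : Fin k → ℕ, (∀ j, c j < 2 ^ (n + 1)) ∧
        A.valuation (inputSum ch θ) ^ 2 ^ n = A.valuation 2 ^ ∑ j, c j * B ^ (j : ℕ) := by
    intro n hn hP ch hch
    let S : Finset (Fin k) := Finset.univ.filter fun i => ch i ∈ leadFuns k n
    have hS : S.Nonempty := by
      obtain ⟨i, hi⟩ := hch.2
      exact ⟨i, by simpa [S] using hi⟩
    have hc : ∀ i, ∃ c : Fin k → ℕ, (∀ j, c j < 2 ^ n) ∧ (i ∈ S →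
        A.valuation (ch i θ) ^ 2 ^ n = A.valuation 2 ^ ∑ j, c j * B ^ (j : ℕ)) := by
      intro i
      by_cases hi : ch i ∈ leadFuns k n
      · obtain ⟨c, h1, h3⟩ := hP _ hi
        exact ⟨c, h1, fun _ => h3⟩
      · exact ⟨0, fun _ => by simp, fun h => absurd (by simpa [S] using h) hi⟩
    choose c hc hcv using hc
    have hx : ∀ i ∈ S, A.valuation (θ.1 i * ch i θ) ^ 2 ^ n = A.valuation 2 ^
        ∑ j, (c i j + if j = i then 2 ^ n else 0) * B ^ (j : ℕ) := by
      intro i hi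
      rw [map_mul, mul_pow, hcv i hi, ha, ← pow_mul, ← pow_add]
      congr 1
      simp [add_mul, Finset.sum_add_distrib, ite_mul]
      ring
    have hMB : 2 * 2 ^ n ≤ B := by
      rw [← pow_succ', hB]
      exact Nat.pow_le_pow_right two_pos (by omega)
    obtain ⟨i, hi, hsum⟩ := exists_valuation_sum_eq h2 hS hMB hc hx
    refine ⟨fun j => c i j + if j = i then 2 ^ n else 0, fun j => ?_, ?_⟩
    · have := hc i j
      rw [pow_succ]
      dsimp only
      split_ifs <;> omega
    · rw [← hx i hi, ← hsum]
      congr 2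
      refine (Finset.sum_subset (Finset.subset_univ S) fun j _ hj => ?_).symm
      have hj' : ch j ∉ leadFuns k n := by simpa [S] using hj
      rw [(hch.1 j).resolve_right hj', Pi.zero_apply, mul_zero]
  have hP : ∀ n ≤ m, ∀ φ ∈ leadFuns k n, ∃ c : Fin k → ℕ, (∀ j, c j < 2 ^ n) ∧
      A.valuation (φ θ) ^ 2 ^ n = A.valuation 2 ^ ∑ j, c j * B ^ (j : ℕ) := by
    intro n
    induction n with
    | zero =>
      intro _ φ hφ
      refine ⟨0, fun _ => by simp, ?_⟩
      have h1 : A.valuation (-2 * θ.2.2 / θ.2.1) = 1 := by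
        rw [map_div₀, map_mul, Valuation.map_neg, hl, hq, mul_one, div_self hγ]
      rcases hφ with rfl | rfl
      · simp [h1, -neg_mul]
      · simp [h1, Valuation.map_neg, -neg_mul]
    | succ n ih =>
      intro hn φ hφ
      simp only [leadFuns, mem_iUnion] at hφ
      obtain ⟨ch, hch, hφ⟩ := hφ
      obtain ⟨c, hc, hcv⟩ := hstep n (by omega) (ih (by omega)) ch hch
      refine ⟨c, hc, ?_⟩
      have hφ2 : φ θ ^ 2 = |2 / θ.2.1 * inputSum ch θ| := by
        rcases hφ with rfl | rfl
        · exact Real.sq_sqrt (abs_nonneg _)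
        · simp only [neg_sq]
          exact Real.sq_sqrt (abs_nonneg _)
      rw [pow_succ', pow_mul, ← map_pow, hφ2, valuation_abs, map_mul, hκ, one_mul, hcv]
  refine ⟨?_, ?_, fun n hn ch hch h0 => ?_⟩
  · rw [← Valuation.ne_zero_iff A.valuation, hq]
    exact hγ
  · rw [← Valuation.ne_zero_iff A.valuation, hl]
    exact one_ne_zero
  · obtain ⟨c, -, hc⟩ := hstep n hn (hP n hn) ch hch
    rw [h0, map_zero, zero_pow (by positivity)] at hc
    exact pow_ne_zero _ hγ hc.symm

theorem dense_nondegenerateJets (k m : ℕ) : Dense (nondegenerateJets k m) := by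
  obtain ⟨A, h2, hodd⟩ := exists_dyadic_valuationSubring
  have h := (dense_pi univ fun (i : Fin k) _ =>
    dense_valuation_eq hodd ((2 ^ (m + 1)) ^ (i : ℕ))).prod
      ((dense_valuation_eq hodd 1).prod (dense_valuation_eq hodd 0))
  refine h.mono ?_
  rintro θ ⟨ha, hq, hl⟩
  exact mem_nondegenerateJets_of_valuation h2 (fun i => ha i (mem_univ i)) hq hl

/-! ### The jet of a smooth family -/

/-- The jet coefficients of a family on which the leading coefficients of branches depend. -/
noncomputable def SmoothFamily.jet {k : ℕ} (f : SmoothFamily k) : JetCoeffs k :=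
  (fun i => fderiv ℝ f.toFun 0 (inputDir i),
    fderiv ℝ (fderiv ℝ f.toFun) 0 (cellDir k) (cellDir k),
    fderiv ℝ (fderiv ℝ f.toFun) 0 (paramDir k) (cellDir k))

theorem SmoothFamily.continuous_iteratedFDeriv_apply {k n : ℕ} (x : ℝ × (Fin k → ℝ) × ℝ)
    (v : Fin n → ℝ × (Fin k → ℝ) × ℝ) :
    Continuous fun f : SmoothFamily k => iteratedFDeriv ℝ n f.toFun x v := by
  have h1 : Continuous fun f : SmoothFamily k => (⟨iteratedFDeriv ℝ n f.toFun,
        f.smooth.continuous_iteratedFDeriv (by exact_mod_cast le_top)⟩ :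
      C(ℝ × (Fin k → ℝ) × ℝ,
        ContinuousMultilinearMap ℝ (fun _ : Fin n => ℝ × (Fin k → ℝ) × ℝ) ℝ)) :=
    continuous_iInf_dom (i := n) continuous_induced_dom
  have h2 : Continuous fun f : SmoothFamily k => iteratedFDeriv ℝ n f.toFun x :=
    (ContinuousEvalConst.continuous_eval_const x).comp h1
  exact (ContinuousMultilinearMap.apply ℝ (fun _ : Fin n => ℝ × (Fin k → ℝ) × ℝ) ℝ
    v).continuous.comp h2

theorem SmoothFamily.continuous_jet (k : ℕ) :
    Continuous (SmoothFamily.jet : SmoothFamily k → JetCoeffs k) := by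
  refine (continuous_pi fun i => ?_).prodMk (Continuous.prodMk ?_ ?_)
  · simpa [iteratedFDeriv_one_apply] using
      SmoothFamily.continuous_iteratedFDeriv_apply 0 ![inputDir i]
  · simpa [iteratedFDeriv_two_apply] using
      SmoothFamily.continuous_iteratedFDeriv_apply 0 ![cellDir k, cellDir k]
  · simpa [iteratedFDeriv_two_apply] using
      SmoothFamily.continuous_iteratedFDeriv_apply 0 ![paramDir k, cellDir k]

/-- The polynomial with the jet coefficients `δ`. -/
noncomputable def jetPolynomial {k : ℕ} (δ : JetCoeffs k) : ℝ × (Fin k → ℝ) × ℝ → ℝ :=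
  (∑ i, δ.1 i • fun p : ℝ × (Fin k → ℝ) × ℝ => p.2.1 i) +
    (δ.2.1 • (fun p : ℝ × (Fin k → ℝ) × ℝ => p.1 ^ 2 / 2) +
      δ.2.2 • fun p : ℝ × (Fin k → ℝ) × ℝ => p.1 * p.2.2)

theorem jetPolynomial_apply {k : ℕ} (δ : JetCoeffs k) (p : ℝ × (Fin k → ℝ) × ℝ) :
    jetPolynomial δ p = ∑ i, δ.1 i * p.2.1 i + (δ.2.1 * (p.1 ^ 2 / 2) + δ.2.2 * (p.1 * p.2.2)) := by
  simp [jetPolynomial]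

theorem contDiff_jetPolynomial {k : ℕ} (δ : JetCoeffs k) : ContDiff ℝ ∞ (jetPolynomial δ) := by
  rw [show jetPolynomial δ = fun p => ∑ i, δ.1 i * p.2.1 i +
    (δ.2.1 * (p.1 ^ 2 / 2) + δ.2.2 * (p.1 * p.2.2)) from funext (jetPolynomial_apply δ)]
  fun_prop

/-- The perturbation of a family by a polynomial. -/
noncomputable def SmoothFamily.perturb {k : ℕ} (f : SmoothFamily k) (δ : JetCoeffs k) :
    SmoothFamily k :=
  ⟨f.toFun + jetPolynomial δ, f.smooth.add (contDiff_jetPolynomial δ)⟩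

theorem SmoothFamily.continuous_perturb {k : ℕ} (f : SmoothFamily k) : Continuous f.perturb := by
  refine continuous_iInf_rng.2 fun n => continuous_induced_rng.2 ?_
  refine ContinuousMap.continuous_of_continuous_uncurry _ ?_
  have hp : ∀ i, ContDiff ℝ n fun p : ℝ × (Fin k → ℝ) × ℝ => p.2.1 i := fun i => by fun_prop
  have hq : ContDiff ℝ n fun p : ℝ × (Fin k → ℝ) × ℝ => p.1 ^ 2 / 2 := by fun_prop
  have hl : ContDiff ℝ n fun p : ℝ × (Fin k → ℝ) × ℝ => p.1 * p.2.2 := by fun_prop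
  have hf : ContDiff ℝ n f.toFun := f.smooth.of_le (by exact_mod_cast le_top)
  have hcont : ∀ {g : ℝ × (Fin k → ℝ) × ℝ → ℝ}, ContDiff ℝ n g →
      Continuous fun p : JetCoeffs k × (ℝ × (Fin k → ℝ) × ℝ) => iteratedFDeriv ℝ n g p.2 :=
    fun hg => (hg.continuous_iteratedFDeriv le_rfl).comp continuous_snd
  have heq : ∀ δ : JetCoeffs k, ∀ x, iteratedFDeriv ℝ n (f.perturb δ).toFun x =
      iteratedFDeriv ℝ n f.toFun x +
        (∑ i, δ.1 i • iteratedFDeriv ℝ n (fun p : ℝ × (Fin k → ℝ) × ℝ => p.2.1 i) x +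
        (δ.2.1 • iteratedFDeriv ℝ n (fun p : ℝ × (Fin k → ℝ) × ℝ => p.1 ^ 2 / 2) x +
          δ.2.2 • iteratedFDeriv ℝ n (fun p : ℝ × (Fin k → ℝ) × ℝ => p.1 * p.2.2) x)) := by
    intro δ x
    have hsum : ContDiff ℝ n (∑ i, δ.1 i • fun p : ℝ × (Fin k → ℝ) × ℝ => p.2.1 i) := by
      have : ContDiff ℝ n fun p : ℝ × (Fin k → ℝ) × ℝ => ∑ i, δ.1 i • p.2.1 i := by fun_prop
      convert this using 1
      ext p
      simp
    have hq' : ContDiff ℝ n (δ.2.1 • fun p : ℝ × (Fin k → ℝ) × ℝ => p.1 ^ 2 / 2) :=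
      hq.const_smul δ.2.1
    have hl' : ContDiff ℝ n (δ.2.2 • fun p : ℝ × (Fin k → ℝ) × ℝ => p.1 * p.2.2) :=
      hl.const_smul δ.2.2
    have hql : ContDiff ℝ n ((δ.2.1 • fun p : ℝ × (Fin k → ℝ) × ℝ => p.1 ^ 2 / 2) +
      δ.2.2 • fun p : ℝ × (Fin k → ℝ) × ℝ => p.1 * p.2.2) := hq'.add hl'
    have hsql : ContDiff ℝ n ((∑ i, δ.1 i • fun p : ℝ × (Fin k → ℝ) × ℝ => p.2.1 i) +
      ((δ.2.1 • fun p : ℝ × (Fin k → ℝ) × ℝ => p.1 ^ 2 / 2) +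
        δ.2.2 • fun p : ℝ × (Fin k → ℝ) × ℝ => p.1 * p.2.2)) := hsum.add hql
    change iteratedFDeriv ℝ n (f.toFun + (_ + (_ + _))) x = _
    rw [iteratedFDeriv_add_apply hf.contDiffAt hsql.contDiffAt,
      iteratedFDeriv_add_apply hsum.contDiffAt hql.contDiffAt,
      iteratedFDeriv_add_apply hq'.contDiffAt hl'.contDiffAt,
      iteratedFDeriv_const_smul_apply hq.contDiffAt, iteratedFDeriv_const_smul_apply hl.contDiffAt]
    congr 2
    have hi : (∑ i, δ.1 i • fun p : ℝ × (Fin k → ℝ) × ℝ => p.2.1 i) =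
        fun p => ∑ i, δ.1 i • p.2.1 i := by
      ext p
      simp
    rw [hi, iteratedFDeriv_sum fun i _ => (hp i).const_smul (δ.1 i)]
    simp only [Finset.sum_apply]
    exact Finset.sum_congr rfl fun i _ =>
      iteratedFDeriv_const_smul_apply (a := δ.1 i) (hp i).contDiffAt
  change Continuous fun p : JetCoeffs k × (ℝ × (Fin k → ℝ) × ℝ) =>
    iteratedFDeriv ℝ n (f.perturb p.1).toFun p.2
  simp only [heq]
  have h1 := fun i => hcont (hp i)
  have h2 := hcont hq
  have h3 := hcont hl
  have h4 := hcont hf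
  fun_prop

theorem fderiv_jetPolynomial {k : ℕ} (δ : JetCoeffs k) (p v : ℝ × (Fin k → ℝ) × ℝ) :
    fderiv ℝ (jetPolynomial δ) p v =
      ∑ i, δ.1 i * v.2.1 i + (δ.2.1 * (p.1 * v.1) + δ.2.2 * (v.1 * p.2.2 + p.1 * v.2.2)) := by
  rw [← ((contDiff_jetPolynomial δ).differentiable (by simp) p).lineDeriv_eq_fderiv]
  have hline : ∀ a b : ℝ, HasDerivAt (fun t : ℝ => a + t * b) b 0 := fun a b => by
    simpa using ((hasDerivAt_id (0 : ℝ)).mul_const b).const_add a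
  have h : HasDerivAt (fun t : ℝ => jetPolynomial δ (p + t • v))
      (∑ i, δ.1 i * v.2.1 i + (δ.2.1 * (p.1 * v.1) + δ.2.2 * (v.1 * p.2.2 + p.1 * v.2.2))) 0 := by
    simp only [jetPolynomial_apply, Prod.fst_add, Prod.snd_add, Prod.smul_fst, Prod.smul_snd,
      Pi.add_apply, Pi.smul_apply, smul_eq_mul]
    have h1 := HasDerivAt.fun_sum (u := Finset.univ)
      fun i _ => (hline (p.2.1 i) (v.2.1 i)).const_mul (δ.1 i)
    have h2 := (((hline p.1 v.1).pow 2).div_const 2).const_mul δ.2.1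
    have h3 := ((hline p.1 v.1).mul (hline p.2.2 v.2.2)).const_mul δ.2.2
    refine (h1.add (h2.add h3)).congr_deriv ?_
    simp only [zero_mul, add_zero, Nat.cast_ofNat]
    ring
  exact h.deriv

theorem fderiv_fderiv_jetPolynomial {k : ℕ} (δ : JetCoeffs k) (v : ℝ × (Fin k → ℝ) × ℝ) :
    fderiv ℝ (fderiv ℝ (jetPolynomial δ)) 0 v (cellDir k) = δ.2.1 * v.1 + δ.2.2 * v.2.2 := by
  have hd : Differentiable ℝ (fderiv ℝ (jetPolynomial δ)) :=
    ((contDiff_jetPolynomial δ).fderiv_right (m := ∞) (by simp)).differentiable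
      (by simp)
  have h1 : HasDerivAt (fun t : ℝ => fderiv ℝ (jetPolynomial δ) (t • v))
      (fderiv ℝ (fderiv ℝ (jetPolynomial δ)) 0 v) 0 := by
    have h2 : HasDerivAt (fun t : ℝ => t • v) v 0 := by
      simpa using (hasDerivAt_id (0 : ℝ)).smul_const v
    have h3 : HasFDerivAt (fderiv ℝ (jetPolynomial δ)) (fderiv ℝ (fderiv ℝ (jetPolynomial δ)) 0)
        ((0 : ℝ) • v) := by
      rw [zero_smul]
      exact (hd 0).hasFDerivAt
    exact h3.comp_hasDerivAt (0 : ℝ) h2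
  have h4 := h1.clm_apply (hasDerivAt_const (0 : ℝ) (cellDir k))
  have h5 : HasDerivAt (fun t : ℝ => t * (δ.2.1 * v.1 + δ.2.2 * v.2.2))
      (δ.2.1 * v.1 + δ.2.2 * v.2.2) 0 := by
    simpa using (hasDerivAt_id (0 : ℝ)).mul_const (δ.2.1 * v.1 + δ.2.2 * v.2.2)
  rw [map_zero, add_zero] at h4
  refine h4.unique (h5.congr_of_eventuallyEq (Eventually.of_forall fun t => ?_))
  simp only [fderiv_jetPolynomial, cellDir]
  simp
  ring

theorem SmoothFamily.jet_perturb {k : ℕ} (f : SmoothFamily k) (δ : JetCoeffs k) :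
    (f.perturb δ).jet = f.jet + δ := by
  have hJ := contDiff_jetPolynomial δ
  have h1 : fderiv ℝ (f.perturb δ).toFun = fderiv ℝ f.toFun + fderiv ℝ (jetPolynomial δ) :=
    funext fun x => fderiv_add (f.smooth.differentiable (by simp) x)
      (hJ.differentiable (by simp) x)
  have h2 : fderiv ℝ (fderiv ℝ (f.perturb δ).toFun) 0 =
      fderiv ℝ (fderiv ℝ f.toFun) 0 + fderiv ℝ (fderiv ℝ (jetPolynomial δ)) 0 := by
    rw [h1]
    exact fderiv_add
      ((f.smooth.fderiv_right (m := ∞) (by simp)).differentiable (by simp) 0)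
      ((hJ.fderiv_right (m := ∞) (by simp)).differentiable (by simp) 0)
  refine Prod.ext (funext fun i => ?_) (Prod.ext ?_ ?_)
  · simp only [SmoothFamily.jet, h1]
    simp [fderiv_jetPolynomial, inputDir, Pi.single_apply]
  · simp only [SmoothFamily.jet, h2]
    rw [add_apply, add_apply, fderiv_fderiv_jetPolynomial]
    simp [cellDir]
  · simp only [SmoothFamily.jet, h2]
    simp [fderiv_fderiv_jetPolynomial, paramDir]

theorem SmoothFamily.deriv_line_eq {k : ℕ} (f : SmoothFamily k) :
    deriv (fun x : ℝ => f.toFun (x, 0, 0)) 0 = fderiv ℝ f.toFun 0 (cellDir k) := by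
  have h1 : HasFDerivAt f.toFun (fderiv ℝ f.toFun 0) ((0 : ℝ), (0 : (Fin k → ℝ) × ℝ)) :=
    (f.smooth.differentiable (by simp) 0).hasFDerivAt
  exact (h1.comp_hasDerivAt (0 : ℝ)
    ((hasDerivAt_id (0 : ℝ)).prodMk (hasDerivAt_const (0 : ℝ) (0 : (Fin k → ℝ) × ℝ)))).deriv

theorem SmoothFamily.perturb_mem {k : ℕ} {f : SmoothFamily k} (hf : f ∈ familiesV₀ k)
    (δ : JetCoeffs k) : f.perturb δ ∈ familiesV₀ k := by
  refine ⟨fun μ => ?_, ?_⟩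
  · simp [SmoothFamily.perturb, jetPolynomial_apply, hf.1 μ]
  · have h := hf.2
    rw [SmoothFamily.deriv_line_eq] at h ⊢
    rw [SmoothFamily.perturb, fderiv_add (f.smooth.differentiable (by simp) 0)
      ((contDiff_jetPolynomial δ).differentiable (by simp) 0), add_apply, h,
      fderiv_jetPolynomial]
    simp [cellDir]

/-- Nondegeneracy of the jet is a generic condition. -/
theorem forGenericV₀_of_nondegenerate {k m : ℕ} {P : SmoothFamily k → Prop}
    (h : ∀ f ∈ familiesV₀ k, f.jet ∈ nondegenerateJets k m → P f) : ForGenericV₀ k P := by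
  refine ⟨{f | (f : SmoothFamily k).jet ∈ nondegenerateJets k m}, ?_, ?_,
    fun f hf => h f f.2 hf⟩
  · exact (isOpen_nondegenerateJets k m).preimage
      ((SmoothFamily.continuous_jet k).comp continuous_subtype_val)
  · rw [dense_iff_inter_open]
    rintro O hO ⟨f, hf⟩
    let pert : JetCoeffs k → familiesV₀ k := fun δ => ⟨(f : SmoothFamily k).perturb δ,
      SmoothFamily.perturb_mem f.2 δ⟩
    have hpert : Continuous pert :=
      ((f : SmoothFamily k).continuous_perturb).subtype_mk _
    have h0 : pert 0 = f := by
      refine Subtype.ext ?_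
      have : jetPolynomial (0 : JetCoeffs k) = 0 := by
        ext p
        simp [jetPolynomial_apply]
      simp [pert, SmoothFamily.perturb, this]
    have hdense : Dense ((fun δ => (f : SmoothFamily k).jet + δ) ⁻¹' nondegenerateJets k m) :=
      (dense_nondegenerateJets k m).preimage
        (Homeomorph.addLeft (f : SmoothFamily k).jet).isOpenMap
    obtain ⟨δ, hδO, hδ⟩ := hdense.inter_open_nonempty _ (hO.preimage hpert)
      ⟨0, by rw [mem_preimage, h0]; exact hf⟩
    refine ⟨pert δ, hδO, ?_⟩
    change ((f : SmoothFamily k).perturb δ).jet ∈ nondegenerateJets k m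
    rw [SmoothFamily.jet_perturb]
    exact hδ

/-! ### Branches on one side of the bifurcation point -/

/-- `x` is an equilibrium branch for small parameters of the sign `ε`, reparametrized by the
absolute value `t` of the parameter. -/
structure Network.IsSideBranch {k : ℕ} {Cell : Type*} (N : Network k Cell) (f : SmoothFamily k)
    (ε : ℝ) (x : ℝ → Cell → ℝ) : Prop where
  continuousAt : ∀ c, ∀ᶠ t in 𝓝[>] 0, ContinuousAt (fun t => x t c) t
  tendsto : ∀ c, Tendsto (fun t => x t c) (𝓝[>] 0) (𝓝 0)
  equilibrium : ∀ᶠ t in 𝓝[>] 0, N.field f (x t) (ε * t) = 0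

/-- `y` grows like the `2 ^ p`-th root, with one of the possible leading coefficients. -/
def HasLead {k : ℕ} (θ : JetCoeffs k) (y : ℝ → ℝ) (p : ℕ) : Prop :=
  ∃ φ ∈ leadFuns k p, RootGerm y p (φ θ)

theorem HasLead.exists_ne_zero {k m p : ℕ} {θ : JetCoeffs k} {y : ℝ → ℝ} (h : HasLead θ y p)
    (hθ : θ ∈ nondegenerateJets k m) (hp : p ≤ m + 1) : ∃ s, s ≠ 0 ∧ RootGerm y p s := by
  obtain ⟨φ, hφ, hy⟩ := h
  exact ⟨φ θ, leadFuns_ne_zero hθ hp hφ, hy⟩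

theorem familiesV₀.fderiv_cellDir {k : ℕ} {f : SmoothFamily k} (hf : f ∈ familiesV₀ k) :
    fderiv ℝ f.toFun 0 (cellDir k) = 0 := by
  rw [← f.deriv_line_eq]
  exact hf.2

section
variable {Cell : Type*} {k m : ℕ} {N : Network k Cell} {f : SmoothFamily k} {ε : ℝ}
  {x : ℝ → Cell → ℝ}

theorem Network.IsSideBranch.eventually_zero_of_self_input (hx : N.IsSideBranch f ε x)
    (hk : 1 ≤ k) (hf : f ∈ familiesV₀ k) (hθ : f.jet ∈ nondegenerateJets k m) {c : Cell}
    (hc : ∀ i, N.input i c = c) : ∀ᶠ t in 𝓝[>] 0, x t c = 0 := by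
  have hsum : ∑ i, fderiv ℝ f.toFun 0 (inputDir i) ≠ 0 := by
    -- this sum is the leading coefficient for equal inputs, up to a factor
    let ch : Fin k → JetCoeffs k → ℝ := fun _ θ => -2 * θ.2.2 / θ.2.1
    have hch : ch ∈ inputChoices (leadFuns k 0) :=
      ⟨fun _ => Or.inr (Or.inl rfl), ⟨0, hk⟩, Or.inl rfl⟩
    have h := hθ.2.2 0 (Nat.zero_le m) ch hch
    intro h0
    refine h ?_
    simp only [inputSum, ch]
    rw [← Finset.sum_mul]
    exact mul_eq_zero_of_left h0 _
  refine _root_.eventually_zero_of_self_input f.smooth hf.1 (familiesV₀.fderiv_cellDir hf) hsum ε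
    (hx.tendsto c) ?_
  filter_upwards [hx.equilibrium] with t ht
  have := congrFun ht c
  simpa [Network.field, hc] using this

theorem Network.IsSideBranch.zero_or_hasLead_zero (hx : N.IsSideBranch f ε x)
    (hε : ε = 1 ∨ ε = -1) (hf : f ∈ familiesV₀ k) (hθ : f.jet ∈ nondegenerateJets k m) {c : Cell}
    (hc : ∀ i, ∀ᶠ t in 𝓝[>] 0, x t (N.input i c) = 0) :
    (∀ᶠ t in 𝓝[>] 0, x t c = 0) ∨ HasLead f.jet (fun t => x t c) 0 := by
  have hε0 : ε ≠ 0 := by rcases hε with rfl | rfl <;> norm_num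
  refine (zero_or_rootGerm_of_zero_inputs f.smooth hf.1 (familiesV₀.fderiv_cellDir hf) hθ.1 hθ.2.1
    hε0 (hx.continuousAt c) (hx.tendsto c) ?_).imp_right fun h => ?_
  · filter_upwards [hx.equilibrium, eventually_all.2 hc] with t h1 h2
    have h3 := congrFun h1 c
    have h4 : (fun i => x t (N.input i c)) = 0 := funext h2
    simpa [Network.field, h4] using h3
  · rcases hε with rfl | rfl
    · rw [one_mul] at h
      exact ⟨_, Or.inl rfl, h⟩
    · rw [neg_one_mul] at h
      exact ⟨_, Or.inr rfl, h⟩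

/-- A cell with a nonvanishing input grows like the square root of its largest inputs: `p` is the
largest order of growth among the inputs. -/
theorem Network.IsSideBranch.hasLead_succ (hx : N.IsSideBranch f ε x)
    (hf : f ∈ familiesV₀ k) (hθ : f.jet ∈ nondegenerateJets k m) {n : ℕ} (hn : n ≤ m) {c : Cell}
    (hc : ∀ i, (∀ᶠ t in 𝓝[>] 0, x t (N.input i c) = 0) ∨
      ∃ p ≤ n, HasLead f.jet (fun t => x t (N.input i c)) p)
    {i₀ : Fin k} {p₀ : ℕ} (hp₀ : p₀ ≤ n) (hi₀ : HasLead f.jet (fun t => x t (N.input i₀ c)) p₀) :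
    ∃ p, p₀ ≤ p ∧ p ≤ n ∧ HasLead f.jet (fun t => x t c) (p + 1) := by
  classical
  let Q : ℕ → Prop := fun p => ∃ i, HasLead f.jet (fun t => x t (N.input i c)) p
  set P := Nat.findGreatest Q n
  have hPn : P ≤ n := Nat.findGreatest_le n
  have hQP : Q P := Nat.findGreatest_spec hp₀ ⟨i₀, hi₀⟩
  have hch : ∀ i, ∃ φ ∈ insert 0 (leadFuns k P),
      (HasLead f.jet (fun t => x t (N.input i c)) P → φ ∈ leadFuns k P) ∧
      RootGerm (fun t => x t (N.input i c)) P (φ f.jet) := by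
    intro i
    by_cases h : HasLead f.jet (fun t => x t (N.input i c)) P
    · obtain ⟨φ, hφ, hr⟩ := h
      exact ⟨φ, Or.inr hφ, fun _ => hφ, hr⟩
    · refine ⟨0, Or.inl rfl, fun h' => absurd h' h, ?_⟩
      rcases hc i with h0 | ⟨p, hpn, hp⟩
      · exact RootGerm.of_eventually_zero h0 P
      · have hle : p ≤ P := Nat.le_findGreatest hpn ⟨i, hp⟩
        have hlt : p < P := lt_of_le_of_ne hle fun h' => h (h' ▸ hp)
        obtain ⟨φ, -, hr⟩ := hp
        exact hr.of_lt hlt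
  choose ch hch1 hch2 hch3 using hch
  have hmem : ch ∈ inputChoices (leadFuns k P) := by
    obtain ⟨i, hi⟩ := hQP
    exact ⟨hch1, i, hch2 i hi⟩
  obtain ⟨d, hd, hroot⟩ := rootGerm_succ_of_inputs f.smooth hf.1 (familiesV₀.fderiv_cellDir hf)
    hθ.1 (ε := ε) (hx.continuousAt c) (hx.tendsto c) hch3 (hθ.2.2 P (hPn.trans hn) ch hmem) (by
      filter_upwards [hx.equilibrium] with t ht using congrFun ht c)
  refine ⟨P, Nat.le_findGreatest hp₀ ⟨i₀, hi₀⟩, hPn, ?_⟩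
  have hd' : √|2 / f.jet.2.1 * inputSum ch f.jet| = |d| := by
    have hX : |2 / f.jet.2.1 * inputSum ch f.jet| = d ^ 2 := by
      rw [← abs_neg, ← abs_of_nonneg (sq_nonneg d)]
      exact congrArg _ hd.symm
    rw [hX, Real.sqrt_sq_eq_abs]
  rcases abs_choice d with h | h
  · refine ⟨fun θ => √|2 / θ.2.1 * inputSum ch θ|,
      mem_biUnion hmem (Or.inl rfl), ?_⟩
    dsimp only
    rwa [hd', h]
  · refine ⟨fun θ => -√|2 / θ.2.1 * inputSum ch θ|,
      mem_biUnion hmem (Or.inr rfl), ?_⟩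
    dsimp only
    rwa [hd', h, neg_neg]

/-- From the first layer `r` on where the branch does not vanish, its order of growth increases by
one from each layer to the next one. -/
theorem Network.IsSideBranch.layers (hx : N.IsSideBranch f ε x) (hε : ε = 1 ∨ ε = -1)
    (hk : 1 ≤ k) {C : Fin (m + 1) → Set Cell} (hN : N.IsFeedForward C)
    (hf : f ∈ familiesV₀ k) (hθ : f.jet ∈ nondegenerateJets k m) :
    (∀ c, ∀ᶠ t in 𝓝[>] 0, x t c = 0) ∨ ∃ r, 1 ≤ r ∧ r ≤ m ∧
      (∀ j : Fin (m + 1), (j : ℕ) < r → ∀ c ∈ C j, ∀ᶠ t in 𝓝[>] 0, x t c = 0) ∧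
      ∀ d, ∀ hd : r + d < m + 1,
        (∀ c ∈ C ⟨r + d, hd⟩, (∀ᶠ t in 𝓝[>] 0, x t c = 0) ∨
          ∃ p ≤ d, HasLead f.jet (fun t => x t c) p) ∧
        ∃ c ∈ C ⟨r + d, hd⟩, HasLead f.jet (fun t => x t c) d := by
  classical
  by_cases hall : ∀ c, ∀ᶠ t in 𝓝[>] 0, x t c = 0
  · exact Or.inl hall
  refine Or.inr ?_
  have hex : ∃ r, ∃ h : r < m + 1, ∃ c ∈ C ⟨r, h⟩, ¬ ∀ᶠ t in 𝓝[>] 0, x t c = 0 := by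
    push Not at hall
    obtain ⟨c, hc⟩ := hall
    obtain ⟨j, hj⟩ := hN.cover c
    exact ⟨j, j.2, c, hj, by simpa using hc⟩
  obtain ⟨hr, c₁, hc₁, hne⟩ := Nat.find_spec hex
  set r := Nat.find hex
  have hzero : ∀ j : Fin (m + 1), (j : ℕ) < r → ∀ c ∈ C j, ∀ᶠ t in 𝓝[>] 0, x t c = 0 := by
    intro j hj c hc
    by_contra h
    exact Nat.find_min hex hj ⟨j.2, c, hc, h⟩
  have hr1 : 1 ≤ r := by
    by_contra h0
    have h0' : r = 0 := by omega
    refine hne (hx.eventually_zero_of_self_input hk hf hθ fun i => hN.first i c₁ ?_)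
    convert hc₁ using 2
    exact Fin.ext h0'.symm
  obtain ⟨r', hr'⟩ : ∃ r', r = r' + 1 := ⟨r - 1, by omega⟩
  refine ⟨r, hr1, by omega, hzero, fun d => ?_⟩
  induction d with
  | zero =>
    intro hd
    have hfirst : ∀ c ∈ C ⟨r + 0, hd⟩, (∀ᶠ t in 𝓝[>] 0, x t c = 0) ∨
        HasLead f.jet (fun t => x t c) 0 := by
      intro c hc
      refine hx.zero_or_hasLead_zero hε hf hθ fun i => ?_
      have hrm : r' < m := by omega
      have hc' : c ∈ C (Fin.succ ⟨r', hrm⟩) := by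
        convert hc using 2
        exact Fin.ext hr'.symm
      exact hzero _ (by simp [hr']) _ (hN.step ⟨r', hrm⟩ i c hc')
    refine ⟨fun c hc => (hfirst c hc).imp_right fun h => ⟨0, le_rfl, h⟩, c₁, hc₁, ?_⟩
    exact (hfirst c₁ hc₁).resolve_left hne
  | succ d ih =>
    intro hd
    have hrd : r + d < m := by omega
    obtain ⟨ih1, c₂, hc₂, hlead⟩ := ih (by omega)
    have hin : ∀ c ∈ C ⟨r + (d + 1), hd⟩, ∀ i, (∀ᶠ t in 𝓝[>] 0, x t (N.input i c) = 0) ∨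
        ∃ p ≤ d, HasLead f.jet (fun t => x t (N.input i c)) p :=
      fun c hc i => ih1 _ (hN.step ⟨r + d, hrd⟩ i c hc)
    constructor
    · intro c hc
      by_cases h : ∀ i, ∀ᶠ t in 𝓝[>] 0, x t (N.input i c) = 0
      · exact (hx.zero_or_hasLead_zero hε hf hθ h).imp_right fun h => ⟨0, Nat.zero_le _, h⟩
      · rw [not_forall] at h
        obtain ⟨i, hi⟩ := h
        obtain ⟨p, hp, hpi⟩ := (hin c hc i).resolve_left hi
        obtain ⟨q, -, hq, hlead'⟩ := hx.hasLead_succ hf hθ (by omega) (hin c hc) hp hpi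
        exact Or.inr ⟨q + 1, by omega, hlead'⟩
    · obtain ⟨c, hc, i, rfl⟩ := hN.source ⟨r + d, hrd⟩ c₂ hc₂
      obtain ⟨q, hq1, hq2, hlead'⟩ := hx.hasLead_succ hf hθ (by omega) (hin c hc) le_rfl hlead
      obtain rfl : q = d := le_antisymm hq2 hq1
      exact ⟨c, hc, hlead'⟩

end

/-! ### Square-root-orders on a branch domain -/

/-- As a neighbourhood of `0`, the set `S` is the half-line of the parameters of the sign `ε`. -/
def IsSide (ε : ℝ) (S : Set ℝ) : Prop :=
  0 ∈ S ∧ 𝓝[S \ {0}] 0 = map (fun t => ε * t) (𝓝[>] 0)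

theorem isSide_Ico {μ₀ : ℝ} (h : 0 < μ₀) : IsSide 1 (Ico 0 μ₀) := by
  refine ⟨⟨le_rfl, h⟩, ?_⟩
  rw [Ico_sdiff_left, nhdsWithin_Ioo_eq_nhdsGT h]
  simp

theorem isSide_Ioc {μ₀ : ℝ} (h : 0 < μ₀) : IsSide (-1) (Ioc (-μ₀) 0) := by
  refine ⟨⟨neg_lt_zero.2 h, le_rfl⟩, ?_⟩
  rw [Ioc_sdiff_right, nhdsWithin_Ioo_eq_nhdsLT (neg_lt_zero.2 h)]
  simp

section
variable {ε : ℝ} {S : Set ℝ} {g : ℝ → ℝ}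

theorem IsSide.eventually_iff (hS : IsSide ε S) {P : ℝ → Prop} (h0 : P 0) :
    (∀ᶠ μ in 𝓝[S] 0, P μ) ↔ ∀ᶠ t in 𝓝[>] 0, P (ε * t) := by
  have h1 : S = insert 0 (S \ {0}) := by
    rw [insert_sdiff_singleton, insert_eq_of_mem hS.1]
  rw [h1, nhdsWithin_insert, eventually_sup, hS.2, eventually_map]
  exact and_iff_right (by simpa using h0)

theorem IsSide.ne_singleton (hS : IsSide ε S) : S ≠ {0} := by
  intro h
  have h1 := hS.2
  rw [h, sdiff_self, nhdsWithin_empty] at h1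
  exact (map_neBot (f := (𝓝[>] (0 : ℝ))) (m := fun t => ε * t)).ne h1.symm

theorem IsSide.germZero_iff (hS : IsSide ε S) (h0 : g 0 = 0) :
    GermZero S g ↔ ∀ᶠ t in 𝓝[>] 0, g (ε * t) = 0 :=
  hS.eventually_iff h0

theorem abs_sign_mul (hε : ε = 1 ∨ ε = -1) {t : ℝ} (ht : 0 < t) : |ε * t| = t := by
  rcases hε with rfl | rfl <;> simp [abs_of_pos ht]

theorem IsSide.hasRootForm (hS : IsSide ε S) (hε : ε = 1 ∨ ε = -1) (h0 : g 0 = 0) {p : ℕ} {s : ℝ}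
    (hg : RootGerm (fun t => g (ε * t)) p s) (hs : s ≠ 0) : HasRootForm S g p (ε * s) := by
  have hε0 : ε ≠ 0 := by rcases hε with rfl | rfl <;> norm_num
  obtain ⟨g', hg', hg0, hgd, heq⟩ := hg
  refine ⟨1, one_pos, g', hg'.contDiffOn, ?_, ?_, mul_ne_zero hε0 hs⟩
  · refine (hS.eventually_iff ?_).2 ?_
    · change g 0 = g' (dyadicRoot p |0|)
      rw [abs_zero, dyadicRoot_apply_zero, h0, hg0]
    · filter_upwards [heq, self_mem_nhdsWithin] with t ht htpos
      rw [abs_sign_mul hε htpos]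
      exact ht
  · rw [hS.2, tendsto_map'_iff]
    have h1 : RootGerm g' 0 s :=
      ⟨g', hg', hg0, hgd, Eventually.of_forall fun t => by rw [dyadicRoot_zero]⟩
    refine (h1.tendsto_div.const_mul ε).congr' ?_
    filter_upwards [self_mem_nhdsWithin] with t ht
    rw [Function.comp_apply, abs_sign_mul hε ht, dyadicRoot_zero]
    rcases hε with rfl | rfl
    · simp
    · simp [div_neg]

theorem IsSide.tendsto_of_hasRootForm (hS : IsSide ε S) (hε : ε = 1 ∨ ε = -1) {p : ℕ} {s : ℝ}
    (h : HasRootForm S g p s) :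
    Tendsto (fun t => g (ε * t) / dyadicRoot p t) (𝓝[>] 0) (𝓝 (ε * s)) := by
  obtain ⟨_, -, g', -, heq, hlim, -⟩ := h
  rw [hS.2, tendsto_map'_iff] at hlim
  have heq' : ∀ᶠ μ in 𝓝[S \ {0}] 0, g μ = g' (|μ| ^ ((2 : ℝ) ^ (-(p : ℝ)))) :=
    heq.filter_mono (nhdsWithin_mono _ sdiff_subset)
  rw [hS.2, eventually_map] at heq'
  refine ((hlim.comp (tendsto_dyadicRoot p)).const_mul ε).congr' ?_
  filter_upwards [heq', self_mem_nhdsWithin] with t h1 h2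
  rw [abs_sign_mul hε h2] at h1
  rw [h1]
  simp only [Function.comp_apply]
  rw [abs_sign_mul hε (dyadicRoot_pos p h2)]
  change _ = g' (dyadicRoot p t) / dyadicRoot p t
  rcases hε with rfl | rfl
  · simp
  · simp [div_neg]

theorem IsSide.hasOneSidedSqrtOrder_zero (hS : IsSide ε S) (h0 : g 0 = 0)
    (hg : ∀ᶠ t in 𝓝[>] 0, g (ε * t) = 0) : HasOneSidedSqrtOrder S g (-1) 0 :=
  Or.inl ⟨(hS.germZero_iff h0).2 hg, rfl, rfl⟩

theorem IsSide.hasOneSidedSqrtOrder (hS : IsSide ε S) (hε : ε = 1 ∨ ε = -1) (h0 : g 0 = 0)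
    {p : ℕ} {s : ℝ} (hg : RootGerm (fun t => g (ε * t)) p s) (hs : s ≠ 0) :
    HasOneSidedSqrtOrder S g p (ε * s) := by
  have hε0 : ε ≠ 0 := by rcases hε with rfl | rfl <;> norm_num
  have hform := hS.hasRootForm hε h0 hg hs
  refine Or.inr ⟨?_, p, rfl, ⟨⟨_, hform⟩, ?_⟩, hform⟩
  · rw [hS.germZero_iff h0]
    exact not_eventually_zero_of_tendsto_div hg.tendsto_div hs
  · rintro q ⟨s', hs'⟩
    have hs'0 : s' ≠ 0 := hs'.choose_spec.2.choose_spec.2.2.2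
    exact (dyadic_order_unique hg.tendsto_div hs (hS.tendsto_of_hasRootForm hε hs')
      (mul_ne_zero hε0 hs'0)).le

end

theorem HasOneSidedSqrtOrder.unique {S : Set ℝ} {g : ℝ → ℝ} {p p' : ℤ} {s s' : ℝ}
    (h : HasOneSidedSqrtOrder S g p s) (h' : HasOneSidedSqrtOrder S g p' s') : p = p' := by
  rcases h with ⟨h1, rfl, -⟩ | ⟨h1, q, rfl, hq, -⟩ <;>
    rcases h' with ⟨h2, rfl, -⟩ | ⟨h2, q', rfl, hq', -⟩
  · rfl
  · exact absurd h1 h2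
  · exact absurd h2 h1
  · rw [hq.unique hq']

theorem Ico_inter_Iic_zero {μ₀ : ℝ} (h : 0 < μ₀) : Ico 0 μ₀ ∩ Iic 0 = {0} := by
  ext t
  simp only [mem_inter_iff, mem_Ico, mem_Iic, mem_singleton_iff]
  constructor
  · intro ht
    linarith [ht.1.1, ht.2]
  · rintro rfl
    exact ⟨⟨le_rfl, h⟩, le_rfl⟩

theorem Ioc_inter_Ici_zero {μ₀ : ℝ} (h : 0 < μ₀) : Ioc (-μ₀) 0 ∩ Ici 0 = {0} := by
  ext t
  simp only [mem_inter_iff, mem_Ioc, mem_Ici, mem_singleton_iff]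
  constructor
  · intro ht
    linarith [ht.1.2, ht.2]
  · rintro rfl
    exact ⟨⟨neg_lt_zero.2 h, le_rfl⟩, le_rfl⟩

theorem Ioo_inter_Ici_zero {μ₀ : ℝ} (h : 0 < μ₀) : Ioo (-μ₀) μ₀ ∩ Ici 0 = Ico 0 μ₀ := by
  ext t
  simp only [mem_inter_iff, mem_Ioo, mem_Ici, mem_Ico]
  exact ⟨fun ht => ⟨ht.2, ht.1.2⟩, fun ht => ⟨⟨by linarith [ht.1], ht.2⟩, ht.1⟩⟩

theorem Ioo_inter_Iic_zero {μ₀ : ℝ} (h : 0 < μ₀) : Ioo (-μ₀) μ₀ ∩ Iic 0 = Ioc (-μ₀) 0 := by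
  ext t
  simp only [mem_inter_iff, mem_Ioo, mem_Iic, mem_Ioc]
  exact ⟨fun ht => ⟨ht.1.1, ht.2⟩, fun ht => ⟨⟨ht.1, by linarith [ht.2]⟩, ht.2⟩⟩

theorem hasSqrtOrder_Ico {μ₀ : ℝ} (h : 0 < μ₀) {g : ℝ → ℝ} {p : ℤ} {s : ℝ} :
    HasSqrtOrder (Ico 0 μ₀) g p s ↔ HasOneSidedSqrtOrder (Ico 0 μ₀) g p s := by
  have h1 : Ico 0 μ₀ ∩ Ici 0 = Ico 0 μ₀ := inter_eq_left.2 fun t ht => ht.1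
  rw [HasSqrtOrder, Ico_inter_Iic_zero h, h1]
  simp [(isSide_Ico h).ne_singleton]

theorem hasSqrtOrder_Ioc {μ₀ : ℝ} (h : 0 < μ₀) {g : ℝ → ℝ} {p : ℤ} {s : ℝ} :
    HasSqrtOrder (Ioc (-μ₀) 0) g p s ↔ HasOneSidedSqrtOrder (Ioc (-μ₀) 0) g p s := by
  have h1 : Ioc (-μ₀) 0 ∩ Iic 0 = Ioc (-μ₀) 0 := inter_eq_left.2 fun t ht => ht.2
  rw [HasSqrtOrder, Ioc_inter_Ici_zero h, h1]
  simp [(isSide_Ioc h).ne_singleton]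

theorem hasSqrtOrder_Ioo {μ₀ : ℝ} (h : 0 < μ₀) {g : ℝ → ℝ} {p : ℤ} {s : ℝ} :
    HasSqrtOrder (Ioo (-μ₀) μ₀) g p s ↔
      HasOneSidedSqrtOrder (Ico 0 μ₀) g p s ∧ HasOneSidedSqrtOrder (Ioc (-μ₀) 0) g p s := by
  rw [HasSqrtOrder, Ioo_inter_Ici_zero h, Ioo_inter_Iic_zero h]
  simp [(isSide_Ico h).ne_singleton, (isSide_Ioc h).ne_singleton]

theorem HasSqrtOrder.unique {D : Set ℝ} (hD : IsBranchDomain D) {g : ℝ → ℝ} {p p' : ℤ} {s s' : ℝ}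
    (h : HasSqrtOrder D g p s) (h' : HasSqrtOrder D g p' s') : p = p' := by
  obtain ⟨μ₀, hμ, rfl | rfl | rfl⟩ := hD
  · exact ((hasSqrtOrder_Ioc hμ).1 h).unique ((hasSqrtOrder_Ioc hμ).1 h')
  · exact ((hasSqrtOrder_Ioo hμ).1 h).1.unique ((hasSqrtOrder_Ioo hμ).1 h').1
  · exact ((hasSqrtOrder_Ico hμ).1 h).unique ((hasSqrtOrder_Ico hμ).1 h')

theorem hasSqrtOrderOn_of {Cell : Type*} {D : Set ℝ} (hD : IsBranchDomain D) {b : ℝ → Cell → ℝ}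
    {A : Set Cell} {n : ℤ}
    (hle : ∀ c ∈ A, ∃ q ≤ n, ∃ s, HasSqrtOrder D (fun μ => b μ c) q s)
    (hex : ∃ c ∈ A, ∃ s, HasSqrtOrder D (fun μ => b μ c) n s) : HasSqrtOrderOn D b A n := by
  refine ⟨fun c hc => ?_, hex, ?_⟩
  · obtain ⟨q, -, s, h⟩ := hle c hc
    exact ⟨q, s, h⟩
  · rintro q ⟨c, hc, s, h⟩
    obtain ⟨q', hq', s', h'⟩ := hle c hc
    rwa [h.unique hD h']

section
variable {Cell : Type*} {k m : ℕ} {N : Network k Cell} {f : SmoothFamily k}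
  {b : ℝ → Cell → ℝ}

theorem Network.IsEquilibriumBranch.isSideBranch [Fintype Cell] {D : Set ℝ}
    (hb : N.IsEquilibriumBranch f D b)
    {ε μ₀ : ℝ} (hμ : 0 < μ₀) (h0 : 0 ∈ D) (hD : ∀ t ∈ Ioo 0 μ₀, D ∈ 𝓝 (ε * t)) :
    N.IsSideBranch f ε fun t => b (ε * t) := by
  have hmem : Ioo 0 μ₀ ∈ 𝓝[>] (0 : ℝ) := Ioo_mem_nhdsGT hμ
  have hε : Continuous fun t : ℝ => ε * t := by fun_prop
  refine ⟨fun c => ?_, fun c => ?_, ?_⟩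
  · filter_upwards [hmem] with t ht
    have h1 : ContinuousAt b (ε * t) := hb.continuousOn.continuousAt (hD t ht)
    exact (continuousAt_pi.1 (h1.comp (f := fun t : ℝ => ε * t) hε.continuousAt)) c
  · have h1 : Tendsto (fun t : ℝ => ε * t) (𝓝[>] 0) (𝓝[D] 0) := by
      refine tendsto_nhdsWithin_iff.2 ⟨?_, ?_⟩
      · exact (hε.tendsto' 0 0 (mul_zero ε)).mono_left nhdsWithin_le_nhds
      · filter_upwards [hmem] with t ht using mem_of_mem_nhds (hD t ht)
    have h2 : Tendsto b (𝓝[D] 0) (𝓝 0) := by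
      have := hb.continuousOn 0 h0
      rwa [ContinuousWithinAt, hb.zero] at this
    exact (tendsto_pi_nhds.1 (h2.comp h1)) c
  · filter_upwards [hmem] with t ht using hb.equilibrium _ (mem_of_mem_nhds (hD t ht))

/-- The assertion on branches on a one-sided domain. -/
theorem Network.IsBifurcationBranch.exists_layer_of_isSide [Fintype Cell] {D : Set ℝ} {ε : ℝ}
    (hb : N.IsBifurcationBranch f D b) (hside : N.IsSideBranch f ε fun t => b (ε * t))
    (hD : IsBranchDomain D) (hS : IsSide ε D) (hε : ε = 1 ∨ ε = -1)
    (hiff : ∀ {g : ℝ → ℝ} {p : ℤ} {s : ℝ}, HasSqrtOrder D g p s ↔ HasOneSidedSqrtOrder D g p s)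
    (hk : 1 ≤ k) {C : Fin (m + 1) → Set Cell} (hN : N.IsFeedForward C)
    (hf : f ∈ familiesV₀ k) (hθ : f.jet ∈ nondegenerateJets k m) :
    ∃ r : ℕ, 1 ≤ r ∧ r ≤ m ∧
      (∀ j : Fin (m + 1), (j : ℕ) < r → ∀ c ∈ C j, GermZero D (fun μ => b μ c)) ∧
      (∀ j : Fin (m + 1), r ≤ (j : ℕ) → HasSqrtOrderOn D b (C j) ((j : ℤ) - (r : ℤ))) := by
  have hb0 : ∀ c, b 0 c = 0 := fun c => congrFun hb.1.zero c
  rcases hside.layers hε hk hN hf hθ with hall | ⟨r, hr1, hrm, hzero, hlead⟩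
  · refine absurd ?_ hb.2
    refine (hS.eventually_iff (P := fun μ => b μ = 0) hb.1.zero).2 ?_
    filter_upwards [eventually_all.2 hall] with t ht using funext ht
  refine ⟨r, hr1, hrm, fun j hj c hc => (hS.germZero_iff (hb0 c)).2 (hzero j hj c hc),
    fun j hj => ?_⟩
  obtain ⟨d, hd⟩ := Nat.exists_eq_add_of_le hj
  have hj' : j = ⟨r + d, by have := j.2; omega⟩ := Fin.ext hd
  obtain ⟨h1, c₁, hc₁, h2⟩ := hlead d (by have := j.2; omega)
  rw [← hj'] at h1 hc₁
  have hjd : ((j : ℕ) : ℤ) - r = d := by rw [hd]; push_cast; ring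
  have horder : ∀ c, ∀ p ≤ d, HasLead f.jet (fun t => b (ε * t) c) p →
      ∃ s, HasSqrtOrder D (fun μ => b μ c) p s := by
    intro c p hp h
    obtain ⟨s, hs, hroot⟩ := h.exists_ne_zero hθ (by have := j.2; omega)
    exact ⟨_, hiff.2 (hS.hasOneSidedSqrtOrder (g := fun μ => b μ c) hε (hb0 c) hroot hs)⟩
  rw [hjd]
  refine hasSqrtOrderOn_of hD (fun c hc => ?_) ⟨c₁, hc₁, horder c₁ d le_rfl h2⟩
  rcases h1 c hc with h | ⟨p, hp, h⟩
  · exact ⟨-1, by omega, 0,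
      hiff.2 (hS.hasOneSidedSqrtOrder_zero (g := fun μ => b μ c) (hb0 c) h)⟩
  · exact ⟨p, by exact_mod_cast hp, horder c p hp h⟩

/-- A branch that is differentiable at the bifurcation point only involves the last layer, as the
states in the layer after `r` grow like a square root. -/
theorem Network.IsSideBranch.zero_or_last {ε : ℝ} {v : Cell → ℝ}
    (hside : N.IsSideBranch f ε fun t => b (ε * t)) (hε : ε = 1 ∨ ε = -1)
    (hv : ∀ c, Tendsto (fun t => b (ε * t) c / t) (𝓝[>] 0) (𝓝 (ε * v c)))
    (hk : 1 ≤ k) {C : Fin (m + 1) → Set Cell} (hN : N.IsFeedForward C)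
    (hf : f ∈ familiesV₀ k) (hθ : f.jet ∈ nondegenerateJets k m) (c : Cell) :
    (v c = 0 ∧ ∀ᶠ t in 𝓝[>] 0, b (ε * t) c = 0) ∨
      (v c ≠ 0 ∧ 1 ≤ m ∧ c ∈ C (Fin.last m) ∧ RootGerm (fun t => b (ε * t) c) 0 (ε * v c)) := by
  have hε0 : ε ≠ 0 := by rcases hε with rfl | rfl <;> norm_num
  have hv' : ∀ c, Tendsto (fun t => b (ε * t) c / dyadicRoot 0 t) (𝓝[>] 0) (𝓝 (ε * v c)) := by
    simpa only [dyadicRoot_zero] using hv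
  have hvzero : ∀ c, (∀ᶠ t in 𝓝[>] 0, b (ε * t) c = 0) → v c = 0 := by
    intro c h
    by_contra hne
    exact not_eventually_zero_of_tendsto_div (hv' c) (mul_ne_zero hε0 hne) h
  by_cases hc : ∀ᶠ t in 𝓝[>] 0, b (ε * t) c = 0
  · exact Or.inl ⟨hvzero c hc, hc⟩
  rcases hside.layers hε hk hN hf hθ with hall | ⟨r, hr1, hrm, hzero, hlead⟩
  · exact absurd (hall c) hc
  have hr : r = m := by
    by_contra hne
    obtain ⟨c', -, h⟩ := (hlead 1 (by omega)).2
    obtain ⟨s, hs, hroot⟩ := h.exists_ne_zero hθ (by omega)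
    exact not_lt_of_tendsto_div (hv' c') hroot.tendsto_div hs one_pos
  subst hr
  obtain ⟨j, hj⟩ := hN.cover c
  have hjlast : j = Fin.last r := by
    by_contra hne
    exact hc (hzero j (Fin.val_lt_last hne) c hj)
  subst hjlast
  obtain ⟨p, hp, h⟩ := ((hlead 0 (by omega)).1 c hj).resolve_left hc
  obtain rfl : p = 0 := by omega
  obtain ⟨s, hs, hroot⟩ := h.exists_ne_zero hθ (by omega)
  have hsv : s = ε * v c := tendsto_nhds_unique hroot.tendsto_div (hv' c)
  rw [hsv] at hs hroot
  exact Or.inr ⟨right_ne_zero_of_mul hs, hr1, hj, hroot⟩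

/-- The assertion on branches on a two-sided domain, where necessarily `r = m`. -/
theorem Network.IsBifurcationBranch.exists_layer_of_two_sided [Fintype Cell] {μ₀ : ℝ} (hμ : 0 < μ₀)
    (hb : N.IsBifurcationBranch f (Ioo (-μ₀) μ₀) b)
    (hk : 1 ≤ k) {C : Fin (m + 1) → Set Cell} (hN : N.IsFeedForward C)
    (hf : f ∈ familiesV₀ k) (hθ : f.jet ∈ nondegenerateJets k m) :
    ∃ r : ℕ, 1 ≤ r ∧ r ≤ m ∧
      (∀ j : Fin (m + 1), (j : ℕ) < r →
        ∀ c ∈ C j, GermZero (Ioo (-μ₀) μ₀) (fun μ => b μ c)) ∧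
      (∀ j : Fin (m + 1), r ≤ (j : ℕ) →
        HasSqrtOrderOn (Ioo (-μ₀) μ₀) b (C j) ((j : ℤ) - (r : ℤ))) := by
  have hb0 : ∀ c, b 0 c = 0 := fun c => congrFun hb.1.zero c
  have hnhds : Ioo (-μ₀) μ₀ ∈ 𝓝 (0 : ℝ) := Ioo_mem_nhds (neg_lt_zero.2 hμ) hμ
  have h0 : (0 : ℝ) ∈ Ioo (-μ₀) μ₀ := mem_of_mem_nhds hnhds
  have hdiff : DifferentiableAt ℝ b 0 := by
    have := hb.1.smooth
    rw [interior_Ioo] at this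
    exact (this.contDiffAt hnhds).differentiableAt (by simp)
  have hder : ∀ c, HasDerivAt (fun μ => b μ c) (deriv b 0 c) 0 :=
    hasDerivAt_pi.1 hdiff.hasDerivAt
  -- the one-sided derivatives at `0`
  have hv : ∀ ε : ℝ, ∀ c, Tendsto (fun t => b (ε * t) c / t) (𝓝[>] 0) (𝓝 (ε * deriv b 0 c)) := by
    intro ε c
    have h1 : HasDerivAt (fun t => b (ε * t) c) (ε * deriv b 0 c) 0 := by
      have h2 : HasDerivAt (fun t : ℝ => ε * t) ε 0 := by
        simpa using (hasDerivAt_id (0 : ℝ)).const_mul ε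
      have h3 : HasDerivAt (fun μ => b μ c) (deriv b 0 c) (ε * 0) := by
        rw [mul_zero]
        exact hder c
      have h4 := h3.comp (0 : ℝ) h2
      rw [mul_comm] at h4
      exact h4
    have h5 := (hasDerivAt_iff_tendsto_slope.1 h1).mono_left
      (nhdsWithin_mono (0 : ℝ) fun x (hx : 0 < x) => (ne_of_gt hx : x ≠ 0))
    refine h5.congr fun t => ?_
    simp [slope_def_field, hb0]
  have hright : N.IsSideBranch f 1 fun t => b (1 * t) := by
    refine hb.1.isSideBranch hμ h0 fun t ht => ?_
    rw [one_mul]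
    exact Ioo_mem_nhds (by linarith [ht.1]) ht.2
  have hleft : N.IsSideBranch f (-1) fun t => b (-1 * t) := by
    refine hb.1.isSideBranch hμ h0 fun t ht => ?_
    rw [neg_one_mul]
    exact Ioo_mem_nhds (by linarith [ht.2]) (by linarith [ht.1])
  have hR := hright.zero_or_last (Or.inl rfl) (hv 1) hk hN hf hθ
  have hL := hleft.zero_or_last (Or.inr rfl) (hv (-1)) hk hN hf hθ
  have hzero : ∀ c, deriv b 0 c = 0 → GermZero (Ico 0 μ₀) (fun μ => b μ c) ∧
      GermZero (Ioc (-μ₀) 0) (fun μ => b μ c) := fun c hc =>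
    ⟨((isSide_Ico hμ).germZero_iff (g := fun μ => b μ c) (hb0 c)).2
        ((hR c).resolve_right fun h => h.1 hc).2,
      ((isSide_Ioc hμ).germZero_iff (g := fun μ => b μ c) (hb0 c)).2
        ((hL c).resolve_right fun h => h.1 hc).2⟩
  have hgerm : ∀ c, deriv b 0 c = 0 → GermZero (Ioo (-μ₀) μ₀) (fun μ => b μ c) := by
    intro c hc
    have h1 : Ioo (-μ₀) μ₀ = Ico 0 μ₀ ∪ Ioc (-μ₀) 0 := by
      rw [← Ioo_inter_Ici_zero hμ, ← Ioo_inter_Iic_zero hμ, ← inter_union_distrib_left,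
        union_comm, Iic_union_Ici, inter_univ]
    rw [GermZero, h1, nhdsWithin_union, eventually_sup]
    exact hzero c hc
  have hne : ∃ c, deriv b 0 c ≠ 0 := by
    by_contra! hall
    refine hb.2 ?_
    have : ∀ᶠ μ in 𝓝[Ioo (-μ₀) μ₀] 0, ∀ c, b μ c = 0 :=
      eventually_all.2 fun c => hgerm c (hall c)
    filter_upwards [this] with μ h using funext h
  obtain ⟨c₁, hc₁⟩ := hne
  obtain ⟨-, hm, hc₁last, -⟩ := (hR c₁).resolve_left fun h => hc₁ h.1
  have horder : ∀ c, deriv b 0 c ≠ 0 →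
      HasSqrtOrder (Ioo (-μ₀) μ₀) (fun μ => b μ c) 0 (deriv b 0 c) := by
    intro c hc
    obtain ⟨-, -, -, h1⟩ := (hR c).resolve_left fun h => hc h.1
    obtain ⟨-, -, -, h2⟩ := (hL c).resolve_left fun h => hc h.1
    rw [hasSqrtOrder_Ioo hμ]
    constructor
    · simpa using (isSide_Ico hμ).hasOneSidedSqrtOrder (g := fun μ => b μ c) (Or.inl rfl) (hb0 c)
        h1 (mul_ne_zero one_ne_zero hc)
    · simpa using (isSide_Ioc hμ).hasOneSidedSqrtOrder (g := fun μ => b μ c) (Or.inr rfl) (hb0 c)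
        h2 (mul_ne_zero (by norm_num) hc)
  refine ⟨m, hm, le_rfl, fun j hj c hc => hgerm c ?_, fun j hj => ?_⟩
  · by_contra hcne
    obtain ⟨-, -, hlast, -⟩ := (hR c).resolve_left fun h => hcne h.1
    have hjl : j ≠ Fin.last m := fun h => by simp [h] at hj
    exact (hN.disjoint j _ hjl).le_bot ⟨hc, hlast⟩
  · obtain rfl : j = Fin.last m := Fin.ext (le_antisymm (Nat.lt_succ_iff.1 j.2) hj)
    rw [Fin.val_last, sub_self]
    refine hasSqrtOrderOn_of ⟨μ₀, hμ, Or.inr (Or.inl rfl)⟩ (fun c _ => ?_)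
      ⟨c₁, hc₁last, _, horder c₁ hc₁⟩
    by_cases hc : deriv b 0 c = 0
    · refine ⟨-1, by norm_num, 0, (hasSqrtOrder_Ioo hμ).2 ?_⟩
      exact ⟨Or.inl ⟨(hzero c hc).1, rfl, rfl⟩, Or.inl ⟨(hzero c hc).2, rfl, rfl⟩⟩
    · exact ⟨0, le_rfl, _, horder c hc⟩

end

theorem mainTheorem4 {Cell : Type*} [Fintype Cell] {k m : ℕ} (hk : 1 ≤ k)
    (N : Network k Cell) (C : Fin (m + 1) → Set Cell) (hN : N.IsFeedForward C) :
    ForGenericV₀ k (fun f =>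
      ∀ (D : Set ℝ) (b : ℝ → Cell → ℝ), IsBranchDomain D → N.IsBifurcationBranch f D b →
        ∃ r : ℕ, 1 ≤ r ∧ r ≤ m ∧
          (∀ j : Fin (m + 1), (j : ℕ) < r → ∀ c ∈ C j, GermZero D (fun μ => b μ c)) ∧
          (∀ j : Fin (m + 1), r ≤ (j : ℕ) → HasSqrtOrderOn D b (C j) ((j : ℤ) - (r : ℤ)))) := by
  refine forGenericV₀_of_nondegenerate (m := m) fun f hf hθ D b hD hb => ?_
  obtain ⟨μ₀, hμ, rfl | rfl | rfl⟩ := id hD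
  · refine hb.exists_layer_of_isSide (ε := -1) (hb.1.isSideBranch hμ (isSide_Ioc hμ).1
      fun t ht => ?_) hD (isSide_Ioc hμ) (Or.inr rfl) (hasSqrtOrder_Ioc hμ) hk hN hf hθ
    rw [neg_one_mul]
    exact Ioc_mem_nhds (by linarith [ht.2]) (by linarith [ht.1])
  · exact hb.exists_layer_of_two_sided hμ hk hN hf hθ
  · refine hb.exists_layer_of_isSide (ε := 1) (hb.1.isSideBranch hμ (isSide_Ico hμ).1
      fun t ht => ?_) hD (isSide_Ico hμ) (Or.inl rfl) (hasSqrtOrder_Ico hμ) hk hN hf hθ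
    rw [one_mul]
    exact Ico_mem_nhds ht.1 ht.2
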